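/- Let $K\subset\mathbb R^2$ be a compact strictly convex set bounded by a curve $\Gamma=\partial K$ of class $\mathcal C^2$. By this we mean that $K$ is a nonempty compact convex set whose support function $p(\varphi)=\sup_{x\in K}\langle x,N(\varphi)\rangle$, $N(\varphi)=(\cos\varphi,\sin\varphi)$, is of class $\mathcal C^2$ with $p+p''>0$ everywhere. Let $F$ be the area of $K$, $L$ the length of $\Gamma$, and $\Delta=L^2-4\pi F$. For a $2\pi$-periodic $\mathcal C^1$ function $f$, the envelope of the lines $\langle x,N(t)\rangle=f(t)$ is called the curve with generalized support function $f$, and the area with multiplicities that it encloses is $\frac12\int_0^{2\pi}(f^2-f'^2)\,dt$. Let $F_e$ be the area with multiplicities enclosed by the evolute of $\Gamma$, that is, by the envelope of the normal lines of $\Gamma$, whose generalized support function is $p'(t-\pi/2)$. For $P\notin K$ let $\omega=\omega(P)$ be the visual angle of $\Gamma$ from $P$, the angle between the two tangents from $P$ to $\Gamma$, and let $dP$ be the area measure. Let $\delta_2(K)$ be the distance in $L^2(S^1)$ between the support function of $K$ and that of its Steiner disk, the disk centred at $s(K)=\frac1\pi\int_0^{2\pi}p(\varphi)N(\varphi)\,d\varphi$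 whose diameter is the mean width of $K$. Then $\sin^3\omega$ is integrable over $\mathbb R^2\setminus K$ and $$\pi|F_e|-\Delta\ \ge\ 20\left(\pi\,\delta_2(K)^2+\frac{L^2}{3}-\frac49\int_{P\notin K}\sin^3\omega\,dP\right).$$ The right-hand side is strictly positive except when $\pi|F_e|-\Delta=0$, in which case it also vanishes. Equality holds if and only if one of the following is true: a) $K$ is a disk, or it is bounded by a curve parallel to an astroid (a hypocycloid with $4$ cusps); b) $K$ is bounded by a curve parallel to a Steiner curve (a hypocycloid with $3$ cusps); c) $K$ is the Minkowski sum of two or more domains of the above types, where the domains bounded by curves parallel to an astroid or a Steiner curve need not be convex, and the Minkowski sum is understood in the sense that the support function of $K$ is the sum of the generalized support functions of the summands. Here a curve is parallel to a hypocycloid if its generalized support function is that of the hypocycloid, in any position and of any size, plus a real constant. -/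

import Mathlib

open Real MeasureTheory
open scoped RealInnerProductSpace

namespace PlaneConvex

noncomputable section

/-- The Euclidean plane. -/
abbrev Plane : Type := EuclideanSpace ℝ (Fin 2)

/-- The unit vector `N(φ) = (cos φ, sin φ)`. -/
def normalVec (φ : ℝ) : Plane := !₂[cos φ, sin φ]

/-- The derivative `N'(φ) = (-sin φ, cos φ)` of `N`. -/
def tangentVec (φ : ℝ) : Plane := !₂[-sin φ, cos φ]

/-- The support function `p(φ) = sup {⟨x, N(φ)⟩ : x ∈ K}` of a set `K` in the plane. -/
def supportFn (K : Set Plane) (φ : ℝ) : ℝ := sSup ((fun x : Plane => ⟪x, normalVec φ⟫) '' K)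

/-- The envelope `f N + f' N'` of the family of lines `⟨x, N(t)⟩ = f(t)`: the curve whose
generalized support function is `f`. -/
def envelope (f : ℝ → ℝ) (t : ℝ) : Plane := f t • normalVec t + deriv f t • tangentVec t

/-- The boundary curve `Γ = ∂K`, parametrized by the direction `φ ∈ [0, 2π]` of its outer normal. -/
def boundaryCurve (K : Set Plane) : ℝ → Plane := envelope (supportFn K)

/-- The length `L` of the closed curve `Γ = ∂K`. -/
def boundaryLength (K : Set Plane) : ℝ := ∫ φ in (0 : ℝ)..(2 * π), ‖deriv (boundaryCurve K) φ‖

/-- The area `F` of `K`. -/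
def area (K : Set Plane) : ℝ := (volume K).toReal

/-- The isoperimetric deficit `Δ = L² - 4πF`. -/
def isoDeficit (K : Set Plane) : ℝ := boundaryLength K ^ 2 - 4 * π * area K

/-- The area with multiplicities enclosed by the closed curve with `2π`-periodic generalized support
function `f`, in the form `(1/2) ∫ (f² - f'²)` that makes sense for `f` of class `C¹`. For `f` of
class `C²` it equals `(1/2) ∫ f (f + f'')`, see `signedArea_eq`. -/
def signedArea (f : ℝ → ℝ) : ℝ := (1 / 2) * ∫ t in (0 : ℝ)..(2 * π), (f t ^ 2 - deriv f t ^ 2)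

/-- For `C²` functions, `signedArea f` is the area `(1/2) ∫ f (f + f'')` swept by the radius vector
of the envelope. -/
theorem signedArea_eq (f : ℝ → ℝ) (hf : ContDiff ℝ 2 f) (hper : Function.Periodic f (2 * π)) :
    signedArea f = (1 / 2) * ∫ t in (0 : ℝ)..(2 * π), f t * (f t + deriv (deriv f) t) := by
  have h1 : ContDiff ℝ 1 (deriv f) := ((contDiff_succ_iff_deriv (n := 1)).1 (by rw [one_add_one_eq_two]; exact hf)).2.2
  have hd : Differentiable ℝ f := hf.differentiable (by norm_num)
  have hd' : Differentiable ℝ (deriv f) := h1.differentiable (by norm_num)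
  have hc'' : Continuous (deriv (deriv f)) := h1.continuous_deriv (by norm_num)
  have hperd : deriv f (2 * π) = deriv f 0 := by
    have : (fun x => f (x + 2 * π)) = f := funext hper
    have h2 := deriv_comp_add_const f (2 * π) 0
    rw [this] at h2
    simpa using h2.symm
  have hper0 : f (2 * π) = f 0 := by simpa using hper 0
  have hparts := intervalIntegral.integral_mul_deriv_eq_deriv_mul (a := 0) (b := 2 * π)
    (fun x _ => (hd x).hasDerivAt) (fun x _ => (hd' x).hasDerivAt)
    (h1.continuous.intervalIntegrable 0 (2 * π)) (hc''.intervalIntegrable 0 (2 * π))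
  have hi : ∀ g : ℝ → ℝ, Continuous g → IntervalIntegrable g volume 0 (2 * π) :=
    fun g hg => hg.intervalIntegrable _ _
  have hfc := hd.continuous
  have hfc' := hd'.continuous
  unfold signedArea
  congr 1
  have e : (fun t => f t * (f t + deriv (deriv f) t))
      = fun t => f t ^ 2 + f t * deriv (deriv f) t := by
    funext t; ring
  rw [e, intervalIntegral.integral_add (hi _ (by fun_prop)) (hi _ (by fun_prop)),
    intervalIntegral.integral_sub (hi _ (by fun_prop)) (hi _ (by fun_prop)), hparts, hperd, hper0]
  simp only [pow_two]
  ring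

/-- The evolute of `Γ` is the envelope of its normal lines. The normal line at the point with outer
normal `N(t - π/2)` passes through that point and is orthogonal to `N(t)`, so that this function is
the generalized support function of the evolute. -/
def evoluteSupportFn (K : Set Plane) (t : ℝ) : ℝ := ⟪boundaryCurve K (t - π / 2), normalVec t⟫

/-- The area with multiplicities `F_e` enclosed by the evolute of `Γ`. -/
def evoluteArea (K : Set Plane) : ℝ := signedArea (evoluteSupportFn K)

/-- The points at which the support lines of `K` through `P` touch `K`. -/
def tangencyPoints (K : Set Plane) (P : Plane) : Set Plane :=
  {x | x ∈ K ∧ ∃ φ : ℝ, ⟪x, normalVec φ⟫ = supportFn K φ ∧ ⟪P, normalVec φ⟫ = supportFn K φ}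

/-- The visual angle `ω` of `Γ` from an exterior point `P`: the angle between the two tangents from
`P` to `Γ`. The set below consists of `0` and of the angle at `P` between the two tangency points. -/
def visualAngle (K : Set Plane) (P : Plane) : ℝ :=
  sSup {θ : ℝ | ∃ x ∈ tangencyPoints K P, ∃ y ∈ tangencyPoints K P, θ = EuclideanGeometry.angle x P y}

/-- The Steiner point `s(K) = (1/π) ∫ p(φ) N(φ) dφ`. -/
def steinerPoint (K : Set Plane) : Plane :=
  (1 / π) • ∫ φ in (0 : ℝ)..(2 * π), supportFn K φ • normalVec φ

/-- The mean over all directions of the width `p(φ) + p(φ + π)` of `K`. -/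
def meanWidth (K : Set Plane) : ℝ :=
  (1 / (2 * π)) * ∫ φ in (0 : ℝ)..(2 * π), (supportFn K φ + supportFn K (φ + π))

/-- The Steiner disk: its center is the Steiner point, its diameter the mean width. -/
def steinerDisk (K : Set Plane) : Set Plane := Metric.closedBall (steinerPoint K) (meanWidth K / 2)

/-- The distance in `L²(S¹)` between the support functions of `K` and of its Steiner disk. -/
def deltaTwo (K : Set Plane) : ℝ :=
  √(∫ φ in (0 : ℝ)..(2 * π), (supportFn K φ - supportFn (steinerDisk K) φ) ^ 2)

/-- The Hurwitz deficit `π|F_e| - Δ`. -/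
def hurwitzDeficit (K : Set Plane) : ℝ := π * |evoluteArea K| - isoDeficit K

/-- The lower bound `20 (π δ₂(K)² + L²/3 - (4/9) ∫_{P ∉ K} sin³ ω dP)`. -/
def deficitBound (K : Set Plane) : ℝ :=
  20 * (π * deltaTwo K ^ 2 + boundaryLength K ^ 2 / 3
    - (4 / 9) * ∫ P in Kᶜ, sin (visualAngle K P) ^ 3)

/-- The hypocycloid with parameters `k` and `r`, traced by a point of a circle of radius `r` that
rolls inside a circle of radius `k r`. -/
def hypocycloid (k r t : ℝ) : Plane :=
  !₂[r * (k - 1) * sin t - r * sin ((k - 1) * t), r * (k - 1) * cos t + r * cos ((k - 1) * t)]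

/-- The generalized support function of `hypocycloid k r`, see `envelope_hypocycloidSupportFn`. -/
def hypocycloidSupportFn (k r θ : ℝ) : ℝ := r * (k - 2) * sin (k / (k - 2) * θ)

theorem envelope_hypocycloidSupportFn (k r : ℝ) (hk : 2 < k) (t : ℝ) :
    envelope (hypocycloidSupportFn k r) ((k - 2) / 2 * t) = hypocycloid k r t := by
  have hk' : k - 2 ≠ 0 := by linarith
  have hder : ∀ θ, deriv (hypocycloidSupportFn k r) θ = r * k * cos (k / (k - 2) * θ) := by
    intro θ
    have h := (((hasDerivAt_id θ).const_mul (k / (k - 2))).sin).const_mul (r * (k - 2))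
    have h' : HasDerivAt (hypocycloidSupportFn k r)
        (r * (k - 2) * (cos (k / (k - 2) * id θ) * (k / (k - 2) * 1))) θ := h
    rw [h'.deriv]
    simp only [id]
    field_simp
  have ha : k / (k - 2) * ((k - 2) / 2 * t) = (k - 2) / 2 * t + t := by field_simp; ring
  have hb : (k - 1) * t = 2 * ((k - 2) / 2 * t) + t := by ring
  have hs := sin_sq_add_cos_sq ((k - 2) / 2 * t)
  set u := (k - 2) / 2 * t with hu
  unfold envelope
  rw [hder, hypocycloidSupportFn, hypocycloid, ha, hb]
  ext i
  fin_cases i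
  · simp [normalVec, tangentVec, sin_add, cos_add, sin_two_mul, cos_two_mul]
    linear_combination (k * r * sin t) * hs
  · simp [normalVec, tangentVec, sin_add, cos_add, sin_two_mul, cos_two_mul]
    linear_combination (r * (k - 2) * cos t) * hs

/-- `h` is the generalized support function of a curve that is parallel, at some distance `d`, to a
hypocycloid with parameter `k` in arbitrary position (rotated by `α` and translated by `c`). For
`k = 3` the hypocycloid is a Steiner curve (deltoid), for `k = 4` an astroid. -/
def IsParallelToHypocycloid (k : ℝ) (h : ℝ → ℝ) : Prop :=
  ∃ r : ℝ, 0 < r ∧ ∃ (α d : ℝ) (c : Plane),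
    ∀ θ, h θ = ⟪c, normalVec θ⟫ + hypocycloidSupportFn k r (θ - α) + d

/-- `K` is a disk. -/
def IsDisk (K : Set Plane) : Prop := ∃ (c : Plane) (R : ℝ), 0 < R ∧ K = Metric.closedBall c R

/-- `K` is bounded by a curve parallel to an astroid. The boundary curve is the envelope with
generalized support function `supportFn K`. -/
def IsBoundedByAstroidParallel (K : Set Plane) : Prop := IsParallelToHypocycloid 4 (supportFn K)

/-- `K` is bounded by a curve parallel to a Steiner curve. -/
def IsBoundedBySteinerParallel (K : Set Plane) : Prop := IsParallelToHypocycloid 3 (supportFn K)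

/-- `h` is the support function of a disk or the generalized support function of a curve, possibly
not convex, that is parallel to an astroid or to a Steiner curve. -/
def IsSummandSupportFn (h : ℝ → ℝ) : Prop :=
  (∃ D : Set Plane, IsDisk D ∧ h = supportFn D) ∨
    IsParallelToHypocycloid 4 h ∨ IsParallelToHypocycloid 3 h

/-- `K` is a Minkowski sum of two or more domains, not necessarily convex, that are disks or bounded
by curves parallel to an astroid or to a Steiner curve. For such domains Minkowski addition is
addition of the generalized support functions. -/
def IsMinkowskiSumOfSummands (K : Set Plane) : Prop :=
  ∃ (m : ℕ) (h : Fin m → ℝ → ℝ), 2 ≤ m ∧ (∀ i, IsSummandSupportFn (h i)) ∧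
    ∀ φ, supportFn K φ = ∑ i, h i φ

end

end PlaneConvex

open PlaneConvex

/-!
In the coordinates given by the two points of contact of the tangents from an exterior point, the
density `sin³ ω dP` becomes a product of two support gaps, quadratic in the support function `p`.
Its integral, like the length, the areas and `δ₂`, is therefore a quadratic form in the Fourier
coefficients of `p`. In terms of the powers `|∫ p(φ) exp(-inφ) dφ|²` the lower bound is
`∑ 10 · power n` and the Hurwitz deficit is `∑ (n² - 1)(n² - 4) / 4 · power n`, both over `|n| ≥ 3`.
The coefficient `(n² - 1)(n² - 4) / 4` is at least `10`, with equality only at `|n| = 3`. Equality of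
the deficits thus means that `p` has no frequency above `3`; the frequencies `0` and `1` are those
of a disk, `2` those of an astroid and `3` those of a Steiner curve.
-/

namespace PlaneConvex

/-! ### Periodic functions -/

section Periodic

variable {f g : ℝ → ℝ} {T : ℝ}

theorem periodic_deriv (hf : Function.Periodic f T) : Function.Periodic (deriv f) T := fun x => by
  rw [← deriv_comp_add_const, hf.funext]

theorem integral_deriv_of_periodic (hf : ContDiff ℝ 1 f) (hfT : Function.Periodic f T) :
    ∫ x in (0 : ℝ)..T, deriv f x = 0 := by
  rw [intervalIntegral.integral_deriv_eq_sub
    (fun x _ => hf.differentiable one_ne_zero x) (hf.continuous_deriv_one.intervalIntegrable _ _),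
    hfT.eq, sub_self]

theorem integral_deriv_mul_of_periodic (hf : ContDiff ℝ 1 f) (hg : ContDiff ℝ 1 g)
    (hfT : Function.Periodic f T) (hgT : Function.Periodic g T) :
    ∫ x in (0 : ℝ)..T, deriv f x * g x = -∫ x in (0 : ℝ)..T, f x * deriv g x := by
  rw [intervalIntegral.integral_mul_deriv_eq_deriv_mul
    (fun x _ => (hf.differentiable one_ne_zero x).hasDerivAt)
    (fun x _ => (hg.differentiable one_ne_zero x).hasDerivAt)
    (hf.continuous_deriv_one.intervalIntegrable _ _)
    (hg.continuous_deriv_one.intervalIntegrable _ _), hfT.eq, hgT.eq]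
  ring

end Periodic

theorem contDiff_one_deriv {f : ℝ → ℝ} (hf : ContDiff ℝ 2 f) : ContDiff ℝ 1 (deriv f) :=
  ContDiff.deriv' (by rwa [one_add_one_eq_two])

/-! ### Fourier coefficients -/

/-- The cosine coefficient `∫ f(θ) cos(nθ) dθ`, without a normalizing factor. -/
noncomputable def cosCoeff (f : ℝ → ℝ) (n : ℤ) : ℝ := ∫ θ in (0 : ℝ)..(2 * π), f θ * cos (n * θ)

/-- The sine coefficient `∫ f(θ) sin(nθ) dθ`, without a normalizing factor. -/
noncomputable def sinCoeff (f : ℝ → ℝ) (n : ℤ) : ℝ := ∫ θ in (0 : ℝ)..(2 * π), f θ * sin (n * θ)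

/-- The power of the frequency `n`: `|∫ f(θ) exp(-inθ) dθ|²`. The frequencies `n` and `-n` are both
present, so that Parseval's identity is a sum over `ℤ`. -/
noncomputable def power (f : ℝ → ℝ) (n : ℤ) : ℝ := cosCoeff f n ^ 2 + sinCoeff f n ^ 2

/-- The trigonometric monomial `x cos(kθ) + y sin(kθ)`. -/
noncomputable def trigMonomial (k : ℤ) (x y θ : ℝ) : ℝ := x * cos (k * θ) + y * sin (k * θ)

section FourierCoefficients

variable {f g : ℝ → ℝ}

theorem power_nonneg (f : ℝ → ℝ) (n : ℤ) : 0 ≤ power f n :=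
  add_nonneg (sq_nonneg _) (sq_nonneg _)

theorem power_eq_zero_iff {n : ℤ} : power f n = 0 ↔ cosCoeff f n = 0 ∧ sinCoeff f n = 0 := by
  rw [power, add_eq_zero_iff_of_nonneg (sq_nonneg _) (sq_nonneg _), sq_eq_zero_iff, sq_eq_zero_iff]

theorem cosCoeff_neg (f : ℝ → ℝ) (n : ℤ) : cosCoeff f (-n) = cosCoeff f n := by simp [cosCoeff]

theorem sinCoeff_neg (f : ℝ → ℝ) (n : ℤ) : sinCoeff f (-n) = -sinCoeff f n := by simp [sinCoeff]

theorem power_neg (f : ℝ → ℝ) (n : ℤ) : power f (-n) = power f n := by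
  simp [power, cosCoeff_neg, sinCoeff_neg]

theorem cosCoeff_zero (f : ℝ → ℝ) : cosCoeff f 0 = ∫ θ in (0 : ℝ)..(2 * π), f θ := by
  simp [cosCoeff]

theorem sinCoeff_zero (f : ℝ → ℝ) : sinCoeff f 0 = 0 := by simp [sinCoeff]

theorem power_zero (f : ℝ → ℝ) : power f 0 = (∫ θ in (0 : ℝ)..(2 * π), f θ) ^ 2 := by
  simp [power, cosCoeff_zero, sinCoeff_zero]

theorem cosCoeff_add (hf : Continuous f) (hg : Continuous g) (n : ℤ) :
    cosCoeff (f + g) n = cosCoeff f n + cosCoeff g n := by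
  simp only [cosCoeff, Pi.add_apply, add_mul]
  exact intervalIntegral.integral_add (Continuous.intervalIntegrable (by fun_prop) _ _)
    (Continuous.intervalIntegrable (by fun_prop) _ _)

theorem sinCoeff_add (hf : Continuous f) (hg : Continuous g) (n : ℤ) :
    sinCoeff (f + g) n = sinCoeff f n + sinCoeff g n := by
  simp only [sinCoeff, Pi.add_apply, add_mul]
  exact intervalIntegral.integral_add (Continuous.intervalIntegrable (by fun_prop) _ _)
    (Continuous.intervalIntegrable (by fun_prop) _ _)

theorem cosCoeff_smul (c : ℝ) (f : ℝ → ℝ) (n : ℤ) : cosCoeff (c • f) n = c * cosCoeff f n := by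
  simp only [cosCoeff, Pi.smul_apply, smul_eq_mul, mul_assoc, intervalIntegral.integral_const_mul]

theorem sinCoeff_smul (c : ℝ) (f : ℝ → ℝ) (n : ℤ) : sinCoeff (c • f) n = c * sinCoeff f n := by
  simp only [sinCoeff, Pi.smul_apply, smul_eq_mul, mul_assoc, intervalIntegral.integral_const_mul]

theorem cosCoeff_sub (hf : Continuous f) (hg : Continuous g) (n : ℤ) :
    cosCoeff (f - g) n = cosCoeff f n - cosCoeff g n := by
  rw [sub_eq_add_neg f, ← neg_one_smul ℝ g, cosCoeff_add hf (hg.const_smul _), cosCoeff_smul]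
  ring

theorem sinCoeff_sub (hf : Continuous f) (hg : Continuous g) (n : ℤ) :
    sinCoeff (f - g) n = sinCoeff f n - sinCoeff g n := by
  rw [sub_eq_add_neg f, ← neg_one_smul ℝ g, sinCoeff_add hf (hg.const_smul _), sinCoeff_smul]
  ring

theorem cosCoeff_sum {ι : Type*} (s : Finset ι) {f : ι → ℝ → ℝ} (hf : ∀ i ∈ s, Continuous (f i))
    (n : ℤ) : cosCoeff (∑ i ∈ s, f i) n = ∑ i ∈ s, cosCoeff (f i) n := by
  simp only [cosCoeff, Finset.sum_apply, Finset.sum_mul]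
  exact intervalIntegral.integral_finsetSum fun i hi =>
    ((hf i hi).mul (by fun_prop)).intervalIntegrable _ _

theorem sinCoeff_sum {ι : Type*} (s : Finset ι) {f : ι → ℝ → ℝ} (hf : ∀ i ∈ s, Continuous (f i))
    (n : ℤ) : sinCoeff (∑ i ∈ s, f i) n = ∑ i ∈ s, sinCoeff (f i) n := by
  simp only [sinCoeff, Finset.sum_apply, Finset.sum_mul]
  exact intervalIntegral.integral_finsetSum fun i hi =>
    ((hf i hi).mul (by fun_prop)).intervalIntegrable _ _

theorem continuous_trigMonomial (k : ℤ) (x y : ℝ) : Continuous (trigMonomial k x y) := by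
  unfold trigMonomial; fun_prop

theorem contDiff_trigMonomial (k : ℤ) (x y : ℝ) {n : WithTop ℕ∞} :
    ContDiff ℝ n (trigMonomial k x y) := by
  unfold trigMonomial; fun_prop

theorem periodic_trigMonomial (k : ℤ) (x y : ℝ) :
    Function.Periodic (trigMonomial k x y) (2 * π) := fun θ => by
  simp only [trigMonomial, mul_add, cos_add_int_mul_two_pi, sin_add_int_mul_two_pi]

theorem deriv_trigMonomial (k : ℤ) (x y : ℝ) :
    deriv (trigMonomial k x y) = trigMonomial k (k * y) (-(k * x)) := by
  funext θ
  have hkθ : HasDerivAt (fun θ : ℝ => k * θ) k θ := by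
    simpa using (hasDerivAt_id θ).const_mul (k : ℝ)
  refine (((hkθ.cos.const_mul x).add (hkθ.sin.const_mul y)).congr_deriv ?_).deriv
  rw [trigMonomial]
  ring

theorem integral_mul_trigMonomial (hf : Continuous f) (k : ℤ) (x y : ℝ) :
    ∫ θ in (0 : ℝ)..(2 * π), f θ * trigMonomial k x y θ = x * cosCoeff f k + y * sinCoeff f k := by
  rw [cosCoeff, sinCoeff, ← intervalIntegral.integral_const_mul,
    ← intervalIntegral.integral_const_mul, ← intervalIntegral.integral_add
      (Continuous.intervalIntegrable (by fun_prop) _ _)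
      (Continuous.intervalIntegrable (by fun_prop) _ _)]
  congr 1 with θ
  rw [trigMonomial]
  ring

theorem cosCoeff_eq_integral_mul_trigMonomial (f : ℝ → ℝ) (n : ℤ) :
    cosCoeff f n = ∫ θ in (0 : ℝ)..(2 * π), f θ * trigMonomial n 1 0 θ := by
  simp [cosCoeff, trigMonomial]

theorem sinCoeff_eq_integral_mul_trigMonomial (f : ℝ → ℝ) (n : ℤ) :
    sinCoeff f n = ∫ θ in (0 : ℝ)..(2 * π), f θ * trigMonomial n 0 1 θ := by
  simp [sinCoeff, trigMonomial]

theorem cosCoeff_deriv (hf : ContDiff ℝ 1 f) (hper : Function.Periodic f (2 * π)) (n : ℤ) :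
    cosCoeff (deriv f) n = n * sinCoeff f n := by
  rw [cosCoeff_eq_integral_mul_trigMonomial, integral_deriv_mul_of_periodic hf
    (contDiff_trigMonomial n 1 0) hper (periodic_trigMonomial n 1 0), deriv_trigMonomial,
    integral_mul_trigMonomial hf.continuous]
  ring

theorem sinCoeff_deriv (hf : ContDiff ℝ 1 f) (hper : Function.Periodic f (2 * π)) (n : ℤ) :
    sinCoeff (deriv f) n = -(n * cosCoeff f n) := by
  rw [sinCoeff_eq_integral_mul_trigMonomial, integral_deriv_mul_of_periodic hf
    (contDiff_trigMonomial n 0 1) hper (periodic_trigMonomial n 0 1), deriv_trigMonomial,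
    integral_mul_trigMonomial hf.continuous]
  ring

theorem power_deriv (hf : ContDiff ℝ 1 f) (hper : Function.Periodic f (2 * π)) (n : ℤ) :
    power (deriv f) n = n ^ 2 * power f n := by
  rw [power, power, cosCoeff_deriv hf hper, sinCoeff_deriv hf hper]
  ring

theorem fourierCoeffOn_two_pi (hf : Continuous f) (n : ℤ) :
    fourierCoeffOn two_pi_pos (fun θ => (f θ : ℂ)) n =
      ((2 * π)⁻¹ : ℝ) * (cosCoeff f n - sinCoeff f n * Complex.I) := by
  have hexp (θ : ℝ) : fourier (-n) (θ : AddCircle (2 * π)) • (f θ : ℂ) =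
      ((f θ * cos (n * θ) : ℝ) : ℂ) - ((f θ * sin (n * θ) : ℝ) : ℂ) * Complex.I := by
    have harg : 2 * (π : ℂ) * Complex.I * ((-n : ℤ) : ℂ) * θ / ((2 * π : ℝ) : ℂ)
        = ((-(n * θ) : ℝ) : ℂ) * Complex.I := by
      push_cast
      field_simp
    rw [smul_eq_mul, fourier_coe_apply, harg, Complex.exp_mul_I, ← Complex.ofReal_cos,
      ← Complex.ofReal_sin, cos_neg, sin_neg]
    push_cast
    ring
  rw [fourierCoeffOn_eq_integral, cosCoeff, sinCoeff, ← intervalIntegral.integral_ofReal,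
    ← intervalIntegral.integral_ofReal, ← intervalIntegral.integral_mul_const,
    ← intervalIntegral.integral_sub (Continuous.intervalIntegrable (by fun_prop) _ _)
      (Continuous.intervalIntegrable (by fun_prop) _ _), sub_zero, Complex.real_smul, one_div]
  exact congrArg _ (intervalIntegral.integral_congr fun θ _ => hexp θ)

theorem hasSum_power (hf : Continuous f) :
    HasSum (power f) (2 * π * ∫ θ in (0 : ℝ)..(2 * π), f θ ^ 2) := by
  have hmem : MemLp (fun θ => (f θ : ℂ)) 2 (volume.restrict (Set.Ioc 0 (2 * π))) :=
    (memLp_two_iff_integrable_sq_norm (by fun_prop)).2 (Continuous.integrableOn_Ioc (by fun_prop))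
  have hnorm (n : ℤ) : (2 * π) ^ 2 * ‖fourierCoeffOn two_pi_pos (fun θ => (f θ : ℂ)) n‖ ^ 2
      = power f n := by
    rw [fourierCoeffOn_two_pi hf, norm_mul, mul_pow ‖_‖ ‖_‖ 2, Complex.norm_real,
      ← Complex.normSq_eq_norm_sq, norm_eq_abs, sq_abs, Complex.normSq_apply, power]
    simp only [Complex.sub_re, Complex.sub_im, Complex.ofReal_re, Complex.ofReal_im,
      Complex.mul_re, Complex.mul_im, Complex.I_re, Complex.I_im]
    field_simp
    ring
  have h := (hasSum_sq_fourierCoeffOn two_pi_pos hmem).mul_left ((2 * π) ^ 2)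
  simp only [hnorm, Complex.norm_real, norm_eq_abs, sq_abs, sub_zero, smul_eq_mul] at h
  convert! h using 1
  field_simp

theorem integral_cos_int_mul (k : ℤ) :
    ∫ θ in (0 : ℝ)..(2 * π), cos (k * θ) = if k = 0 then 2 * π else 0 := by
  split_ifs with hk
  · simp [hk]
  · have hk' : (k : ℝ) ≠ 0 := by exact_mod_cast hk
    rw [intervalIntegral.integral_comp_mul_left _ hk', integral_cos, mul_zero, sin_zero,
      ← sub_zero (k * (2 * π)), sin_int_mul_two_pi_sub, sin_zero]
    simp

theorem integral_sin_int_mul (k : ℤ) : ∫ θ in (0 : ℝ)..(2 * π), sin (k * θ) = 0 := by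
  rcases eq_or_ne (k : ℝ) 0 with hk | hk
  · simp [hk]
  · rw [intervalIntegral.integral_comp_mul_left _ hk, integral_sin, mul_zero, cos_zero,
      cos_int_mul_two_pi]
    simp

theorem cosCoeff_trigMonomial (k : ℤ) (x y : ℝ) (n : ℤ) :
    cosCoeff (trigMonomial k x y) n =
      π * x * ((if n = k then 1 else 0) + (if n = -k then 1 else 0)) := by
  have hprod (θ : ℝ) : trigMonomial k x y θ * cos (n * θ) =
      x / 2 * (cos ((k - n : ℤ) * θ) + cos ((k + n : ℤ) * θ)) +
        y / 2 * (sin ((k - n : ℤ) * θ) + sin ((k + n : ℤ) * θ)) := by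
    push_cast
    rw [trigMonomial, sub_mul (k : ℝ), add_mul (k : ℝ), cos_sub, cos_add, sin_sub, sin_add]
    ring
  have hk : k - n = 0 ↔ n = k := by omega
  have hk' : k + n = 0 ↔ n = -k := by omega
  simp only [cosCoeff, hprod]
  rw [intervalIntegral.integral_add, intervalIntegral.integral_const_mul,
    intervalIntegral.integral_const_mul, intervalIntegral.integral_add,
    intervalIntegral.integral_add, integral_cos_int_mul, integral_cos_int_mul, integral_sin_int_mul,
    integral_sin_int_mul]
  · simp only [hk, hk']
    split_ifs <;> ring
  all_goals exact Continuous.intervalIntegrable (by fun_prop) _ _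

theorem sinCoeff_trigMonomial (k : ℤ) (x y : ℝ) (n : ℤ) :
    sinCoeff (trigMonomial k x y) n =
      π * y * ((if n = k then 1 else 0) - (if n = -k then 1 else 0)) := by
  have hprod (θ : ℝ) : trigMonomial k x y θ * sin (n * θ) =
      y / 2 * (cos ((k - n : ℤ) * θ) - cos ((k + n : ℤ) * θ)) +
        x / 2 * (sin ((k + n : ℤ) * θ) - sin ((k - n : ℤ) * θ)) := by
    push_cast
    rw [trigMonomial, sub_mul (k : ℝ), add_mul (k : ℝ), cos_sub, cos_add, sin_sub, sin_add]
    ring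
  have hk : k - n = 0 ↔ n = k := by omega
  have hk' : k + n = 0 ↔ n = -k := by omega
  simp only [sinCoeff, hprod]
  rw [intervalIntegral.integral_add, intervalIntegral.integral_const_mul,
    intervalIntegral.integral_const_mul, intervalIntegral.integral_sub,
    intervalIntegral.integral_sub, integral_cos_int_mul, integral_cos_int_mul, integral_sin_int_mul,
    integral_sin_int_mul]
  · simp only [hk, hk']
    split_ifs <;> ring
  all_goals exact Continuous.intervalIntegrable (by fun_prop) _ _

/-- The partial sum of order `N` of the Fourier series of `f`. The sum runs over positive and
negative frequencies, hence the factor `1 / (2π)`. -/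
noncomputable def fourierSum (f : ℝ → ℝ) (N : ℕ) : ℝ → ℝ :=
  (2 * π)⁻¹ • ∑ k ∈ Finset.Icc (-N : ℤ) N, trigMonomial k (cosCoeff f k) (sinCoeff f k)

theorem fourierSum_apply (f : ℝ → ℝ) (N : ℕ) (θ : ℝ) : fourierSum f N θ =
    (2 * π)⁻¹ * ∑ k ∈ Finset.Icc (-N : ℤ) N, trigMonomial k (cosCoeff f k) (sinCoeff f k) θ := by
  simp [fourierSum]

theorem continuous_fourierSum (f : ℝ → ℝ) (N : ℕ) : Continuous (fourierSum f N) := by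
  rw [funext (fourierSum_apply f N)]
  have := continuous_trigMonomial
  fun_prop

theorem periodic_fourierSum (f : ℝ → ℝ) (N : ℕ) : Function.Periodic (fourierSum f N) (2 * π) :=
  fun θ => by simp only [fourierSum_apply, periodic_trigMonomial _ _ _ θ]

theorem cosCoeff_fourierSum (f : ℝ → ℝ) (N : ℕ) (n : ℤ) :
    cosCoeff (fourierSum f N) n = if n ∈ Finset.Icc (-N : ℤ) N then cosCoeff f n else 0 := by
  have hneg : -n ∈ Finset.Icc (-N : ℤ) N ↔ n ∈ Finset.Icc (-N : ℤ) N := by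
    simp only [Finset.mem_Icc]; omega
  rw [fourierSum, cosCoeff_smul, cosCoeff_sum _ fun k _ => continuous_trigMonomial k _ _]
  simp only [cosCoeff_trigMonomial, eq_comm (a := n), neg_eq_iff_eq_neg, mul_add, mul_ite, mul_one,
    mul_zero, Finset.sum_add_distrib, Finset.sum_ite_eq', hneg, cosCoeff_neg]
  split_ifs
  · field_simp
    ring
  · ring

theorem sinCoeff_fourierSum (f : ℝ → ℝ) (N : ℕ) (n : ℤ) :
    sinCoeff (fourierSum f N) n = if n ∈ Finset.Icc (-N : ℤ) N then sinCoeff f n else 0 := by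
  have hneg : -n ∈ Finset.Icc (-N : ℤ) N ↔ n ∈ Finset.Icc (-N : ℤ) N := by
    simp only [Finset.mem_Icc]; omega
  rw [fourierSum, sinCoeff_smul, sinCoeff_sum _ fun k _ => continuous_trigMonomial k _ _]
  simp only [sinCoeff_trigMonomial, eq_comm (a := n), neg_eq_iff_eq_neg, mul_sub, mul_ite, mul_one,
    mul_zero, Finset.sum_sub_distrib, Finset.sum_ite_eq', hneg, sinCoeff_neg]
  split_ifs
  · field_simp
    ring
  · ring

theorem power_sub_fourierSum (hf : Continuous f) (N : ℕ) (n : ℤ) :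
    power (f - fourierSum f N) n = if n ∈ Finset.Icc (-N : ℤ) N then 0 else power f n := by
  have hS := continuous_fourierSum f N
  rw [power, cosCoeff_sub hf hS, sinCoeff_sub hf hS, cosCoeff_fourierSum, sinCoeff_fourierSum]
  split_ifs <;> simp [power]

theorem eq_zero_of_power_eq_zero (hf : Continuous f) (hper : Function.Periodic f (2 * π))
    (h : ∀ n, power f n = 0) : f = 0 := by
  by_contra! hne
  obtain ⟨θ, hθ⟩ := Function.ne_iff.1 hne
  obtain ⟨η, hη, hθη⟩ := hper.exists_mem_Ico₀ two_pi_pos θ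
  have hpos : 0 < ∫ θ in (0 : ℝ)..(2 * π), f θ ^ 2 :=
    intervalIntegral.integral_pos two_pi_pos (by fun_prop) (fun _ _ => sq_nonneg _)
      ⟨η, Set.Ico_subset_Icc_self hη, sq_pos_of_ne_zero (hθη ▸ hθ)⟩
  have hzero : HasSum (power f) 0 := by simpa only [funext h] using hasSum_zero
  exact (mul_pos two_pi_pos hpos).ne' ((hasSum_power hf).unique hzero)

/-- The continuous functions all of whose frequencies lie in `[-N, N]`. -/
def bandLimited (N : ℕ) : Submodule ℝ (ℝ → ℝ) where
  carrier := {f | Continuous f ∧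
    ∀ n ∉ Finset.Icc (-N : ℤ) N, cosCoeff f n = 0 ∧ sinCoeff f n = 0}
  add_mem' := fun ⟨hf, hf'⟩ ⟨hg, hg'⟩ => ⟨hf.add hg, fun n hn => by
    simp [cosCoeff_add hf hg, sinCoeff_add hf hg, hf' n hn, hg' n hn]⟩
  zero_mem' := ⟨continuous_zero, fun n _ => by simp [cosCoeff, sinCoeff]⟩
  smul_mem' := fun c _ ⟨hf, hf'⟩ => ⟨hf.const_smul c, fun n hn => by
    simp [cosCoeff_smul, sinCoeff_smul, hf' n hn]⟩

theorem trigMonomial_mem_bandLimited {N : ℕ} {k : ℤ} (hk : k ∈ Finset.Icc (-N : ℤ) N) (x y : ℝ) :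
    trigMonomial k x y ∈ bandLimited N := by
  refine ⟨continuous_trigMonomial k x y, fun n hn => ?_⟩
  have hk₁ : n ≠ k := by rintro rfl; exact hn hk
  have hk₂ : n ≠ -k := by rintro rfl; simp only [Finset.mem_Icc] at hn hk; omega
  simp [cosCoeff_trigMonomial, sinCoeff_trigMonomial, hk₁, hk₂]

theorem mem_bandLimited_iff (hf : Continuous f) {N : ℕ} :
    f ∈ bandLimited N ↔ ∀ n ∉ Finset.Icc (-N : ℤ) N, power f n = 0 := by
  simp only [power_eq_zero_iff]
  exact and_iff_right hf

theorem eq_fourierSum_of_mem_bandLimited {N : ℕ} (hf : f ∈ bandLimited N)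
    (hper : Function.Periodic f (2 * π)) : f = fourierSum f N := by
  refine sub_eq_zero.1 (eq_zero_of_power_eq_zero (hf.1.sub (continuous_fourierSum f N))
    (hper.sub (periodic_fourierSum f N)) fun n => ?_)
  rw [power_sub_fourierSum hf.1]
  split_ifs with hn
  exacts [rfl, (mem_bandLimited_iff hf.1).1 hf n hn]

end FourierCoefficients

/-! ### The moving frame -/

theorem inner_normalVec (x : Plane) (φ : ℝ) : ⟪x, normalVec φ⟫ = x 0 * cos φ + x 1 * sin φ := by
  simp [normalVec, PiLp.inner_apply, mul_comm]

theorem inner_tangentVec (x : Plane) (φ : ℝ) :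
    ⟪x, tangentVec φ⟫ = -(x 0 * sin φ) + x 1 * cos φ := by
  simp [tangentVec, PiLp.inner_apply, mul_comm]

theorem inner_normalVec_normalVec (φ ψ : ℝ) : ⟪normalVec φ, normalVec ψ⟫ = cos (ψ - φ) := by
  rw [inner_normalVec, cos_sub]
  simp [normalVec]
  ring

theorem inner_tangentVec_normalVec (φ ψ : ℝ) : ⟪tangentVec φ, normalVec ψ⟫ = sin (ψ - φ) := by
  rw [inner_normalVec, sin_sub]
  simp [tangentVec]
  ring

theorem normalVec_add_pi_div_two (φ : ℝ) : normalVec (φ + π / 2) = tangentVec φ := by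
  simp only [normalVec, tangentVec, cos_add_pi_div_two, sin_add_pi_div_two]

theorem normalVec_add_pi (φ : ℝ) : normalVec (φ + π) = -normalVec φ := by
  ext i
  fin_cases i <;> simp [normalVec]

theorem periodic_normalVec : Function.Periodic normalVec (2 * π) := fun φ => by simp [normalVec]

theorem periodic_tangentVec : Function.Periodic tangentVec (2 * π) := fun φ => by simp [tangentVec]

theorem norm_normalVec (φ : ℝ) : ‖normalVec φ‖ = 1 := by
  rw [norm_eq_sqrt_real_inner, inner_normalVec_normalVec, sub_self, cos_zero, sqrt_one]

theorem norm_tangentVec (φ : ℝ) : ‖tangentVec φ‖ = 1 := by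
  rw [← normalVec_add_pi_div_two, norm_normalVec]

theorem inner_smul_normalVec_add (x : Plane) (φ : ℝ) :
    ⟪x, normalVec φ⟫ • normalVec φ + ⟪x, tangentVec φ⟫ • tangentVec φ = x := by
  rw [inner_normalVec, inner_tangentVec]
  ext i
  fin_cases i <;> simp only [normalVec, tangentVec]
  · simp
    linear_combination x 0 * sin_sq_add_cos_sq φ
  · simp
    linear_combination x 1 * sin_sq_add_cos_sq φ

theorem hasDerivAt_normalVec (φ : ℝ) : HasDerivAt normalVec (tangentVec φ) φ := by
  have h : HasDerivAt (fun φ => ![cos φ, sin φ]) ![-sin φ, cos φ] φ := by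
    refine hasDerivAt_pi.2 fun i => ?_
    fin_cases i
    exacts [hasDerivAt_cos φ, hasDerivAt_sin φ]
  exact (PiLp.continuousLinearEquiv 2 ℝ fun _ : Fin 2 => ℝ).symm.hasFDerivAt.comp_hasDerivAt φ h

theorem hasDerivAt_tangentVec (φ : ℝ) : HasDerivAt tangentVec (-normalVec φ) φ := by
  have h := (hasDerivAt_normalVec (φ + π / 2)).comp_add_const φ (π / 2)
  rw [← normalVec_add_pi_div_two, add_assoc, add_halves, normalVec_add_pi] at h
  simpa only [normalVec_add_pi_div_two] using h

theorem hasDerivAt_inner_normalVec (x : Plane) (φ : ℝ) :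
    HasDerivAt (fun φ => ⟪x, normalVec φ⟫) ⟪x, tangentVec φ⟫ φ := by
  simpa using (hasDerivAt_const φ x).inner ℝ (hasDerivAt_normalVec φ)

theorem exists_eq_smul_normalVec (v : Plane) : ∃ r φ : ℝ, 0 ≤ r ∧ v = r • normalVec φ := by
  refine ⟨‖(⟨v 0, v 1⟩ : ℂ)‖, Complex.arg ⟨v 0, v 1⟩, norm_nonneg _, ?_⟩
  have hcos := Complex.norm_mul_cos_arg ⟨v 0, v 1⟩
  have hsin := Complex.norm_mul_sin_arg ⟨v 0, v 1⟩
  ext i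
  fin_cases i
  exacts [hcos.symm, hsin.symm]

/-! ### Support functions -/

section SupportFn

variable {K : Set Plane}

theorem inner_le_supportFn (hcomp : IsCompact K) {x : Plane} (hx : x ∈ K) (φ : ℝ) :
    ⟪x, normalVec φ⟫ ≤ supportFn K φ :=
  le_csSup (hcomp.image (by fun_prop)).bddAbove ⟨x, hx, rfl⟩

theorem exists_inner_eq_supportFn (hne : K.Nonempty) (hcomp : IsCompact K) (φ : ℝ) :
    ∃ x ∈ K, ⟪x, normalVec φ⟫ = supportFn K φ :=
  (hcomp.image (by fun_prop)).sSup_mem (hne.image _)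

theorem periodic_supportFn (K : Set Plane) : Function.Periodic (supportFn K) (2 * π) := fun φ => by
  simp only [supportFn, periodic_normalVec φ]

theorem supportFn_add_pi_nonneg (hne : K.Nonempty) (hcomp : IsCompact K) (φ : ℝ) :
    0 ≤ supportFn K φ + supportFn K (φ + π) := by
  obtain ⟨x, hx⟩ := hne
  have hφ := inner_le_supportFn hcomp hx φ
  have hφπ := inner_le_supportFn hcomp hx (φ + π)
  rw [normalVec_add_pi, inner_neg_right] at hφπ
  linarith

theorem mem_iff_inner_le_supportFn (hne : K.Nonempty) (hcomp : IsCompact K) (hconv : Convex ℝ K)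
    (x : Plane) : x ∈ K ↔ ∀ φ, ⟪x, normalVec φ⟫ ≤ supportFn K φ := by
  refine ⟨fun hx φ => inner_le_supportFn hcomp hx φ, fun h => ?_⟩
  by_contra hx
  obtain ⟨f, u, hf, hu⟩ := geometric_hahn_banach_closed_point hconv hcomp.isClosed hx
  obtain ⟨r, φ, hr, hv⟩ := exists_eq_smul_normalVec ((InnerProductSpace.toDual ℝ Plane).symm f)
  have hf_eq (y : Plane) : f y = r * ⟪y, normalVec φ⟫ := by
    rw [← InnerProductSpace.toDual_symm_apply, hv, real_inner_smul_left, real_inner_comm]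
  obtain ⟨y, hy, hyφ⟩ := exists_inner_eq_supportFn hne hcomp φ
  have hlt : r * supportFn K φ < r * ⟪x, normalVec φ⟫ := by
    rw [← hyφ, ← hf_eq, ← hf_eq]
    exact (hf y hy).trans hu
  exact (mul_le_mul_of_nonneg_left (h φ) hr).not_gt hlt

theorem inner_tangentVec_eq_deriv_supportFn (hcomp : IsCompact K) {φ : ℝ}
    (hd : DifferentiableAt ℝ (supportFn K) φ) {x : Plane} (hx : x ∈ K)
    (h : ⟪x, normalVec φ⟫ = supportFn K φ) : ⟪x, tangentVec φ⟫ = deriv (supportFn K) φ := by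
  have hmin : IsLocalMin (supportFn K - fun φ => ⟪x, normalVec φ⟫) φ :=
    .of_forall fun ψ => by
      simpa only [Pi.sub_apply, h, sub_self, sub_nonneg] using inner_le_supportFn hcomp hx ψ
  have hzero := hmin.hasDerivAt_eq_zero (hd.hasDerivAt.sub (hasDerivAt_inner_normalVec x φ))
  exact (sub_eq_zero.1 hzero).symm

theorem eq_boundaryCurve (hcomp : IsCompact K) {φ : ℝ} (hd : DifferentiableAt ℝ (supportFn K) φ)
    {x : Plane} (hx : x ∈ K) (h : ⟪x, normalVec φ⟫ = supportFn K φ) : x = boundaryCurve K φ := by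
  rw [boundaryCurve, envelope, ← inner_tangentVec_eq_deriv_supportFn hcomp hd hx h, ← h,
    inner_smul_normalVec_add]

theorem boundaryCurve_mem (hne : K.Nonempty) (hcomp : IsCompact K) {φ : ℝ}
    (hd : DifferentiableAt ℝ (supportFn K) φ) : boundaryCurve K φ ∈ K := by
  obtain ⟨x, hx, h⟩ := exists_inner_eq_supportFn hne hcomp φ
  rwa [← eq_boundaryCurve hcomp hd hx h]

end SupportFn

/-! ### Support gaps -/

/-- The signed distance from the envelope point `φ` to the support line with normal angle `φ + s`
(see `sub_inner_tangentPoint`). -/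
noncomputable def supportGap (p : ℝ → ℝ) (φ s : ℝ) : ℝ :=
  p (φ + s) - p φ * cos s - deriv p φ * sin s

section SupportGap

variable {p : ℝ → ℝ}

theorem supportGap_zero (p : ℝ → ℝ) (φ : ℝ) : supportGap p φ 0 = 0 := by simp [supportGap]

theorem supportGap_add_two_pi (hper : Function.Periodic p (2 * π)) (φ s : ℝ) :
    supportGap p φ (s + 2 * π) = supportGap p φ s := by
  rw [supportGap, supportGap, ← add_assoc, hper, cos_add_two_pi, sin_add_two_pi]

theorem hasDerivAt_supportGap (hp : Differentiable ℝ p) (φ s : ℝ) :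
    HasDerivAt (supportGap p φ) (deriv p (φ + s) + p φ * sin s - deriv p φ * cos s) s := by
  refine ((((hp (φ + s)).hasDerivAt.comp_const_add φ s).sub
    ((hasDerivAt_cos s).const_mul (p φ))).sub
    ((hasDerivAt_sin s).const_mul (deriv p φ))).congr_deriv ?_
  ring

/-- Variation of constants: `s ↦ supportGap p φ s` solves `g'' + g = p + p''` with zero initial
data. -/
theorem supportGap_eq_integral (hp : ContDiff ℝ 2 p) (φ s : ℝ) :
    supportGap p φ s = ∫ u in 0..s, (p (φ + u) + deriv (deriv p) (φ + u)) * sin (s - u) := by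
  have hp' := contDiff_one_deriv hp
  have := hp'.continuous_deriv_one
  have := hp.continuous
  have hderiv (u : ℝ) :
      HasDerivAt (fun u => deriv p (φ + u) * sin (s - u) + p (φ + u) * cos (s - u))
        ((p (φ + u) + deriv (deriv p) (φ + u)) * sin (s - u)) u := by
    have hsu : HasDerivAt (fun u => s - u) (-1) u := (hasDerivAt_id u).const_sub s
    refine ((((hp'.differentiable one_ne_zero _).hasDerivAt.comp_const_add φ u).mul hsu.sin).add
      (((hp.differentiable two_ne_zero _).hasDerivAt.comp_const_add φ u).mul
        hsu.cos)).congr_deriv ?_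
    ring
  rw [intervalIntegral.integral_eq_sub_of_hasDerivAt (fun u _ => hderiv u)
    (Continuous.intervalIntegrable (by fun_prop) _ _)]
  simp [supportGap]
  ring

theorem supportGap_pos (hp : ContDiff ℝ 2 p) (hpos : ∀ φ, 0 < p φ + deriv (deriv p) φ) (φ : ℝ)
    {s : ℝ} (hs0 : 0 < s) (hs : s ≤ π) : 0 < supportGap p φ s := by
  have := (contDiff_one_deriv hp).continuous_deriv_one
  have := hp.continuous
  rw [supportGap_eq_integral hp]
  exact intervalIntegral.intervalIntegral_pos_of_pos_on
    (Continuous.intervalIntegrable (by fun_prop) _ _)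
    (fun u hu => mul_pos (hpos _)
      (sin_pos_of_pos_of_lt_pi (by linarith [hu.2]) (by linarith [hu.1])))
    hs0

theorem supportGap_neg_pos (hp : ContDiff ℝ 2 p) (hpos : ∀ φ, 0 < p φ + deriv (deriv p) φ) (φ : ℝ)
    {s : ℝ} (hs0 : 0 < s) (hs : s ≤ π) : 0 < supportGap p φ (-s) := by
  have := (contDiff_one_deriv hp).continuous_deriv_one
  have := hp.continuous
  rw [supportGap_eq_integral hp, intervalIntegral.integral_symm, ← intervalIntegral.integral_neg]
  exact intervalIntegral.intervalIntegral_pos_of_pos_on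
    (Continuous.intervalIntegrable (by fun_prop) _ _)
    (fun u hu => neg_pos.2 (mul_neg_of_pos_of_neg (hpos _)
      (sin_neg_of_neg_of_neg_pi_lt (by linarith [hu.1]) (by linarith [hu.2]))))
    (neg_lt_zero.2 hs0)

theorem supportGap_pos_of_lt_two_pi (hp : ContDiff ℝ 2 p) (hper : Function.Periodic p (2 * π))
    (hpos : ∀ φ, 0 < p φ + deriv (deriv p) φ) (φ : ℝ) {s : ℝ} (hs0 : 0 < s) (hs : s < 2 * π) :
    0 < supportGap p φ s := by
  rcases le_total s π with hsπ | hsπ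
  · exact supportGap_pos hp hpos φ hs0 hsπ
  · have h := supportGap_neg_pos hp hpos φ (s := 2 * π - s) (by linarith) (by linarith)
    rwa [neg_sub, ← supportGap_add_two_pi hper, sub_add_cancel] at h

end SupportGap

/-! ### Tangent rays -/

/-- The point at signed distance `t` from the envelope point on the tangent line with normal
angle `φ`. -/
noncomputable def tangentPoint (p : ℝ → ℝ) (φ t : ℝ) : Plane := envelope p φ + t • tangentVec φ

/-- The length of the tangent segment from the intersection of the support lines with normal angles
`φ` and `φ + s` to the envelope point `φ`. It has the junk value `0` when the lines are parallel. -/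
noncomputable def tangentLength (p : ℝ → ℝ) (φ s : ℝ) : ℝ := supportGap p φ s / sin s

section TangentRays

variable {p : ℝ → ℝ}

theorem tangentPoint_eq (p : ℝ → ℝ) (φ t : ℝ) :
    tangentPoint p φ t = p φ • normalVec φ + (deriv p φ + t) • tangentVec φ := by
  rw [tangentPoint, envelope, add_smul, add_assoc]

theorem sub_inner_tangentPoint (p : ℝ → ℝ) (φ t s : ℝ) :
    p (φ + s) - ⟪tangentPoint p φ t, normalVec (φ + s)⟫ = supportGap p φ s - t * sin s := by
  rw [tangentPoint_eq, inner_add_left, real_inner_smul_left, real_inner_smul_left,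
    inner_normalVec_normalVec, inner_tangentVec_normalVec, add_sub_cancel_left, supportGap]
  ring

theorem inner_tangentPoint_normalVec (p : ℝ → ℝ) (φ t : ℝ) :
    ⟪tangentPoint p φ t, normalVec φ⟫ = p φ := by
  symm
  simpa [supportGap_zero, sub_eq_zero] using sub_inner_tangentPoint p φ t 0

theorem inner_tangentPoint_tangentVec (p : ℝ → ℝ) (φ t : ℝ) :
    ⟪tangentPoint p φ t, tangentVec φ⟫ = deriv p φ + t := by
  rw [← normalVec_add_pi_div_two, tangentPoint_eq, inner_add_left, real_inner_smul_left,
    real_inner_smul_left, inner_normalVec_normalVec, inner_tangentVec_normalVec]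
  simp

theorem tangentPoint_sub_deriv_of_inner_eq {φ : ℝ} {P : Plane} (h : ⟪P, normalVec φ⟫ = p φ) :
    tangentPoint p φ (⟪P, tangentVec φ⟫ - deriv p φ) = P := by
  rw [tangentPoint_eq, add_sub_cancel, ← h, inner_smul_normalVec_add]

theorem periodic_tangentPoint (hper : Function.Periodic p (2 * π)) (t : ℝ) :
    Function.Periodic (fun φ => tangentPoint p φ t) (2 * π) := fun φ => by
  simp only [tangentPoint_eq, hper φ, periodic_deriv hper φ, periodic_normalVec φ,
    periodic_tangentVec φ]

theorem tangentLength_pos (hp : ContDiff ℝ 2 p) (hpos : ∀ φ, 0 < p φ + deriv (deriv p) φ) (φ : ℝ)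
    {s : ℝ} (hs : s ∈ Set.Ioo 0 π) : 0 < tangentLength p φ s :=
  div_pos (supportGap_pos hp hpos φ hs.1 hs.2.le) (sin_pos_of_mem_Ioo hs)

theorem hasDerivAt_tangentLength (hp : Differentiable ℝ p) (φ : ℝ) {s : ℝ} (hs : sin s ≠ 0) :
    HasDerivAt (tangentLength p φ) (supportGap p (φ + s) (-s) / sin s ^ 2) s := by
  refine ((hasDerivAt_supportGap hp φ s).div (hasDerivAt_sin s) hs).congr_deriv ?_
  rw [supportGap, supportGap, sin_neg, cos_neg, add_neg_cancel_right]
  congr 1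
  linear_combination p φ * sin_sq_add_cos_sq s

theorem continuousOn_tangentLength (hp : Differentiable ℝ p) (φ : ℝ) :
    ContinuousOn (tangentLength p φ) (Set.Ioo 0 π) := fun _ hs =>
  (hasDerivAt_tangentLength hp φ (sin_pos_of_mem_Ioo hs).ne').continuousAt.continuousWithinAt

theorem strictMonoOn_tangentLength (hp : ContDiff ℝ 2 p) (hpos : ∀ φ, 0 < p φ + deriv (deriv p) φ)
    (φ : ℝ) : StrictMonoOn (tangentLength p φ) (Set.Ioo 0 π) := by
  have hd := hp.differentiable two_ne_zero
  refine strictMonoOn_of_deriv_pos (convex_Ioo 0 π) (continuousOn_tangentLength hd φ) fun s hs => ?_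
  rw [interior_Ioo] at hs
  have hsin := sin_pos_of_mem_Ioo hs
  rw [(hasDerivAt_tangentLength hd φ hsin.ne').deriv]
  exact div_pos (supportGap_neg_pos hp hpos _ hs.1 hs.2.le) (pow_pos hsin 2)

theorem tendsto_tangentLength_nhdsGT_zero (hp : Differentiable ℝ p) (φ : ℝ) :
    Filter.Tendsto (tangentLength p φ) (nhdsWithin 0 (Set.Ioi 0)) (nhds 0) := by
  have hgap := (hasDerivAt_supportGap hp φ 0).tendsto_slope_zero_right
  have hsin := (hasDerivAt_sin 0).tendsto_slope_zero_right
  have hdiv := hgap.div hsin (by simp)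
  simp only [zero_add, add_zero, supportGap_zero, sin_zero, cos_zero, sub_zero, mul_zero, mul_one,
    sub_self, zero_div, smul_eq_mul] at hdiv
  refine hdiv.congr' ?_
  filter_upwards [self_mem_nhdsWithin] with s hs
  exact mul_div_mul_left _ _ (inv_ne_zero (ne_of_gt hs))

theorem tendsto_tangentLength_nhdsLT_pi (hp : ContDiff ℝ 2 p)
    (hpos : ∀ φ, 0 < p φ + deriv (deriv p) φ) (φ : ℝ) :
    Filter.Tendsto (tangentLength p φ) (nhdsWithin π (Set.Iio π)) Filter.atTop := by
  have hgap := (hasDerivAt_supportGap (hp.differentiable two_ne_zero) φ π).continuousAt.tendsto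
  have hsin : Filter.Tendsto sin (nhdsWithin π (Set.Iio π)) (nhdsWithin 0 (Set.Ioi 0)) := by
    refine tendsto_nhdsWithin_iff.2
      ⟨(sin_pi ▸ continuous_sin.tendsto π).mono_left nhdsWithin_le_nhds, ?_⟩
    filter_upwards [Ioo_mem_nhdsLT pi_pos] with s hs using sin_pos_of_mem_Ioo hs
  exact (hgap.mono_left nhdsWithin_le_nhds).pos_mul_atTop
    (supportGap_pos hp hpos φ pi_pos le_rfl) hsin.inv_tendsto_nhdsGT_zero

theorem image_tangentLength (hp : ContDiff ℝ 2 p) (hpos : ∀ φ, 0 < p φ + deriv (deriv p) φ)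
    (φ : ℝ) : tangentLength p φ '' Set.Ioo 0 π = Set.Ioi 0 := by
  have hd := hp.differentiable two_ne_zero
  refine (Set.image_subset_iff.2 fun s hs => tangentLength_pos hp hpos φ hs).antisymm ?_
  exact isPreconnected_Ioo.intermediate_value_Ioi
    (nhdsWithin_Ioo_eq_nhdsGT pi_pos ▸ Filter.le_principal_iff.2 self_mem_nhdsWithin)
    (nhdsWithin_Ioo_eq_nhdsLT pi_pos ▸ Filter.le_principal_iff.2 self_mem_nhdsWithin)
    (continuousOn_tangentLength hd φ)
    (tendsto_tangentLength_nhdsGT_zero hd φ) (tendsto_tangentLength_nhdsLT_pi hp hpos φ)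

theorem inner_tangentPoint_eq_iff (hp : ContDiff ℝ 2 p) (hper : Function.Periodic p (2 * π))
    (hpos : ∀ φ, 0 < p φ + deriv (deriv p) φ) (φ : ℝ) {s t : ℝ} (ht : 0 < t) (hs0 : 0 < s)
    (hs : s < 2 * π) :
    ⟪tangentPoint p φ t, normalVec (φ + s)⟫ = p (φ + s) ↔ s < π ∧ tangentLength p φ s = t := by
  rw [eq_comm, ← sub_eq_zero, sub_inner_tangentPoint, sub_eq_zero]
  constructor
  · intro h
    have hgap := supportGap_pos_of_lt_two_pi hp hper hpos φ hs0 hs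
    have hsin : 0 < sin s := pos_of_mul_pos_right (h ▸ hgap) ht.le
    have hsπ : s < π := by
      by_contra! hπs
      have := sin_nonneg_of_nonneg_of_le_pi (x := s - π) (by linarith) (by linarith)
      rw [sin_sub_pi] at this
      linarith
    exact ⟨hsπ, (div_eq_iff hsin.ne').2 h⟩
  · rintro ⟨hsπ, h⟩
    exact (div_eq_iff (sin_pos_of_mem_Ioo ⟨hs0, hsπ⟩).ne').1 h

theorem tangentPoint_injOn (hp : ContDiff ℝ 2 p) (hper : Function.Periodic p (2 * π))
    (hpos : ∀ φ, 0 < p φ + deriv (deriv p) φ) :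
    Set.InjOn (fun x : ℝ × ℝ => tangentPoint p x.1 x.2) (Set.Ioc 0 (2 * π) ×ˢ Set.Ioi 0) := by
  have not_lt_of_eq {a b t u : ℝ} (ha : 0 < a) (hb : b ≤ 2 * π) (ht : 0 < t) (hu : 0 < u)
      (h : tangentPoint p a t = tangentPoint p b u) : ¬a < b := fun hab => by
    have hab' := (inner_tangentPoint_eq_iff hp hper hpos a ht (sub_pos.2 hab) (by linarith)).1
      (by rw [h, add_sub_cancel, inner_tangentPoint_normalVec])
    have hba' := (inner_tangentPoint_eq_iff hp hper hpos b hu (s := a + 2 * π - b) (by linarith)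
      (by linarith)).1 (by rw [← h, add_sub_cancel, periodic_normalVec, hper,
        inner_tangentPoint_normalVec])
    linarith [hab'.1, hba'.1]
  rintro ⟨a, t⟩ ⟨ha, ht⟩ ⟨b, u⟩ ⟨hb, hu⟩ h
  obtain rfl : a = b := le_antisymm (not_lt.1 (not_lt_of_eq hb.1 ha.2 hu ht h.symm))
    (not_lt.1 (not_lt_of_eq ha.1 hb.2 ht hu h))
  have htu := congrArg (⟪·, tangentVec a⟫) h
  simp only [inner_tangentPoint_tangentVec, add_right_inj] at htu
  rw [htu]

end TangentRays

/-! ### The exterior of an oval -/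

/-- A compact strictly convex set bounded by a curve of class `C²`, expressed through its support
function; `supportFn K + deriv (deriv (supportFn K))` is the radius of curvature of the boundary. -/
structure IsOval (K : Set Plane) : Prop where
  nonempty : K.Nonempty
  isCompact : IsCompact K
  convex : Convex ℝ K
  contDiff_supportFn : ContDiff ℝ 2 (supportFn K)
  curvatureRadius_pos : ∀ φ, 0 < supportFn K φ + deriv (deriv (supportFn K)) φ

/-- The intersection of the support lines with normal angles `φ` and `φ + s`. -/
noncomputable def tangentMeet (p : ℝ → ℝ) (φ s : ℝ) : Plane :=
  tangentPoint p φ (tangentLength p φ s)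

theorem tangentPoint_notMem {K : Set Plane} (hcomp : IsCompact K) {φ t : ℝ}
    (hd : DifferentiableAt ℝ (supportFn K) φ) (ht : t ≠ 0) :
    tangentPoint (supportFn K) φ t ∉ K := fun h => ht <| by
  have htan :=
    inner_tangentVec_eq_deriv_supportFn hcomp hd h (inner_tangentPoint_normalVec _ φ t)
  rwa [inner_tangentPoint_tangentVec, add_eq_left] at htan

theorem exists_inner_sub_eq_supportFn {K : Set Plane} (hne : K.Nonempty) (hcomp : IsCompact K)
    (hcont : Continuous (supportFn K)) {P : Plane} {ψ : ℝ}
    (hψ : supportFn K ψ < ⟪P, normalVec ψ⟫) :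
    ∃ s ∈ Set.Ioo 0 π, ⟪P, normalVec (ψ - s)⟫ = supportFn K (ψ - s) := by
  have hopp : ⟪P, normalVec (ψ - π)⟫ < supportFn K (ψ - π) := by
    have hwidth := supportFn_add_pi_nonneg hne hcomp (ψ - π)
    have hneg : normalVec ψ = -normalVec (ψ - π) := by rw [← normalVec_add_pi, sub_add_cancel]
    rw [sub_add_cancel] at hwidth
    rw [hneg, inner_neg_right] at hψ
    linarith
  have hnormal : Continuous normalVec :=
    continuous_iff_continuousAt.2 fun φ => (hasDerivAt_normalVec φ).continuousAt
  have hdist : Continuous fun s => supportFn K (ψ - s) - ⟪P, normalVec (ψ - s)⟫ := by fun_prop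
  obtain ⟨s, hs, hzero⟩ := intermediate_value_Ioo pi_pos.le hdist.continuousOn
    (Set.mem_Ioo.2 ⟨by simpa using hψ, sub_pos.2 hopp⟩)
  exact ⟨s, hs, (sub_eq_zero.1 hzero).symm⟩

namespace IsOval

variable {K : Set Plane}

theorem differentiable_supportFn (hK : IsOval K) : Differentiable ℝ (supportFn K) :=
  hK.contDiff_supportFn.differentiable two_ne_zero

theorem exists_tangentPoint_eq (hK : IsOval K) {P : Plane} (hP : P ∉ K) :
    ∃ φ ∈ Set.Ioc 0 (2 * π), ∃ t, 0 < t ∧ tangentPoint (supportFn K) φ t = P := by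
  obtain ⟨ψ, hψ⟩ : ∃ ψ, supportFn K ψ < ⟪P, normalVec ψ⟫ := by
    rw [mem_iff_inner_le_supportFn hK.nonempty hK.isCompact hK.convex] at hP
    simpa using hP
  obtain ⟨s, hs, hsupp⟩ := exists_inner_sub_eq_supportFn hK.nonempty hK.isCompact
    hK.contDiff_supportFn.continuous hψ
  have hP := tangentPoint_sub_deriv_of_inner_eq hsupp
  set t := ⟪P, tangentVec (ψ - s)⟫ - deriv (supportFn K) (ψ - s)
  have ht : 0 < t := by
    have hdist := sub_inner_tangentPoint (supportFn K) (ψ - s) t s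
    have hgap := supportGap_pos hK.contDiff_supportFn hK.curvatureRadius_pos (ψ - s) hs.1 hs.2.le
    rw [hP, sub_add_cancel] at hdist
    exact pos_of_mul_pos_left (by linarith) (sin_pos_of_mem_Ioo hs).le
  obtain ⟨φ, hφ, heq⟩ := (periodic_tangentPoint (periodic_supportFn K) t).exists_mem_Ioc
    two_pi_pos (ψ - s) 0
  rw [zero_add] at hφ
  exact ⟨φ, hφ, t, ht, heq.symm.trans hP⟩

theorem image_tangentPoint (hK : IsOval K) :
    (fun x : ℝ × ℝ => tangentPoint (supportFn K) x.1 x.2) '' (Set.Ioc 0 (2 * π) ×ˢ Set.Ioi 0) =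
      Kᶜ := by
  ext P
  constructor
  · rintro ⟨⟨φ, t⟩, ⟨-, ht⟩, rfl⟩
    exact tangentPoint_notMem hK.isCompact (hK.differentiable_supportFn φ) (ne_of_gt ht)
  · intro hP
    obtain ⟨φ, hφ, t, ht, rfl⟩ := hK.exists_tangentPoint_eq hP
    exact ⟨(φ, t), ⟨hφ, ht⟩, rfl⟩

theorem image_tangentMeet (hK : IsOval K) :
    (fun x : ℝ × ℝ => tangentMeet (supportFn K) x.1 x.2) '' (Set.Ioc 0 (2 * π) ×ˢ Set.Ioo 0 π) =
      Kᶜ := by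
  rw [← hK.image_tangentPoint]
  ext P
  constructor
  · rintro ⟨⟨φ, s⟩, ⟨hφ, hs⟩, rfl⟩
    have ht := tangentLength_pos hK.contDiff_supportFn hK.curvatureRadius_pos φ hs
    exact ⟨(φ, tangentLength (supportFn K) φ s), ⟨hφ, ht⟩, rfl⟩
  · rintro ⟨⟨φ, t⟩, ⟨hφ, ht⟩, rfl⟩
    rw [← image_tangentLength hK.contDiff_supportFn hK.curvatureRadius_pos φ] at ht
    obtain ⟨s, hs, rfl⟩ := ht
    exact ⟨(φ, s), ⟨hφ, hs⟩, rfl⟩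

end IsOval

/-! ### Integration in tangent coordinates -/

/-- The measurable identification of `ℝ × ℝ` with the Euclidean plane, needed because the
change of variables formula is about self-maps of a single space. -/
noncomputable def planeEquiv : (ℝ × ℝ) ≃ᵐ Plane :=
  MeasurableEquiv.finTwoArrow.symm.trans (MeasurableEquiv.toLp 2 (Fin 2 → ℝ))

theorem measurePreserving_planeEquiv : MeasurePreserving planeEquiv :=
  (PiLp.volume_preserving_toLp (Fin 2)).comp ((volume_preserving_finTwoArrow ℝ).symm _)

theorem det_eq_of_prod (L : ℝ × ℝ →L[ℝ] ℝ × ℝ) :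
    L.det = (L (1, 0)).1 * (L (0, 1)).2 - (L (0, 1)).1 * (L (1, 0)).2 := by
  rw [ContinuousLinearMap.det, ← LinearMap.det_toMatrix (Module.Basis.finTwoProd ℝ),
    Matrix.det_fin_two]
  simp [LinearMap.toMatrix_apply]

/-- The sweep of the plane by tangent rays in Cartesian coordinates: the point at distance `T x`
from the envelope point on the tangent line with normal angle `x.1`. -/
noncomputable def tangentSweep (p : ℝ → ℝ) (T : ℝ × ℝ → ℝ) (x : ℝ × ℝ) : ℝ × ℝ :=
  planeEquiv.symm (tangentPoint p x.1 (T x))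

section TangentSweep

variable {p : ℝ → ℝ} {T β : ℝ × ℝ → ℝ}

theorem tangentSweep_eq (p : ℝ → ℝ) (T : ℝ × ℝ → ℝ) (x : ℝ × ℝ) :
    tangentSweep p T x =
      (p x.1 * cos x.1 - (deriv p x.1 + T x) * sin x.1,
        p x.1 * sin x.1 + (deriv p x.1 + T x) * cos x.1) := by
  change ((tangentPoint p x.1 (T x)) 0, (tangentPoint p x.1 (T x)) 1) = _
  simp [tangentPoint_eq, normalVec, tangentVec, sub_eq_add_neg]

theorem exists_hasFDerivAt_tangentSweep (hp : ContDiff ℝ 2 p) {x : ℝ × ℝ}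
    (hT : DifferentiableAt ℝ T x) (hβ : HasDerivAt (fun s => T (x.1, s)) (β x) x.2) :
    ∃ L : ℝ × ℝ →L[ℝ] ℝ × ℝ, HasFDerivAt (tangentSweep p T) L x ∧ L.det = -(β x * T x) := by
  have hβ' : fderiv ℝ T x (0, 1) = β x :=
    (hT.hasFDerivAt.comp_hasDerivAt x.2
      ((hasDerivAt_const x.2 x.1).prodMk (hasDerivAt_id _))).unique hβ
  have hfst (g : ℝ → ℝ) (hg : Differentiable ℝ g) : HasFDerivAt (fun y : ℝ × ℝ => g y.1)
      (deriv g x.1 • ContinuousLinearMap.fst ℝ ℝ ℝ) x :=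
    (hg x.1).hasDerivAt.comp_hasFDerivAt (f := Prod.fst) x hasFDerivAt_fst
  have h0 := hfst p (hp.differentiable two_ne_zero)
  have h1 := (hfst _ ((contDiff_one_deriv hp).differentiable one_ne_zero)).add hT.hasFDerivAt
  have hcos := hfst _ differentiable_cos
  have hsin := hfst _ differentiable_sin
  refine ⟨_, (((h0.mul hcos).sub (h1.mul hsin)).prodMk
    ((h0.mul hsin).add (h1.mul hcos))).congr_of_eventuallyEq
    (.of_forall (tangentSweep_eq p T)), ?_⟩
  rw [det_eq_of_prod]
  simp [hβ']
  linear_combination (-β x * T x) * sin_sq_add_cos_sq x.1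

theorem injOn_tangentSweep (hp : ContDiff ℝ 2 p) (hper : Function.Periodic p (2 * π))
    (hpos : ∀ φ, 0 < p φ + deriv (deriv p) φ) {I : Set ℝ} (hT : ∀ φ, ∀ s ∈ I, 0 < T (φ, s))
    (hinj : ∀ φ, Set.InjOn (fun s => T (φ, s)) I) :
    Set.InjOn (tangentSweep p T) (Set.Ioc 0 (2 * π) ×ˢ I) := by
  rintro ⟨a, s⟩ ⟨ha, hs⟩ ⟨b, u⟩ ⟨hb, hu⟩ h
  obtain ⟨rfl, hsu⟩ := Prod.mk.inj <| tangentPoint_injOn hp hper hpos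
    (show (a, T (a, s)) ∈ _ from ⟨ha, hT a s hs⟩) (show (b, T (b, u)) ∈ _ from ⟨hb, hT b u hu⟩)
    (planeEquiv.symm.injective h)
  exact Prod.ext rfl (hinj a hs hu hsu)

theorem planeEquiv_image_tangentSweep (S : Set (ℝ × ℝ)) :
    planeEquiv '' (tangentSweep p T '' S) = (fun x => tangentPoint p x.1 (T x)) '' S := by
  rw [Set.image_image]
  simp only [tangentSweep, MeasurableEquiv.apply_symm_apply]

variable {I : Set ℝ}

theorem integrableOn_image_tangentPoint_iff (hp : ContDiff ℝ 2 p)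
    (hper : Function.Periodic p (2 * π)) (hpos : ∀ φ, 0 < p φ + deriv (deriv p) φ)
    (hI : MeasurableSet I) (hT : ∀ φ, ∀ s ∈ I, 0 < T (φ, s))
    (hinj : ∀ φ, Set.InjOn (fun s => T (φ, s)) I) (hd : ∀ x, x.2 ∈ I → DifferentiableAt ℝ T x)
    (hβ : ∀ x, x.2 ∈ I → HasDerivAt (fun s => T (x.1, s)) (β x) x.2) (g : Plane → ℝ) :
    IntegrableOn g ((fun x => tangentPoint p x.1 (T x)) '' (Set.Ioc 0 (2 * π) ×ˢ I)) ↔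
      IntegrableOn (fun x => |β x * T x| * g (tangentPoint p x.1 (T x)))
        (Set.Ioc 0 (2 * π) ×ˢ I) := by
  choose! L hL hdet using fun (x : ℝ × ℝ) (hx : x ∈ Set.Ioc 0 (2 * π) ×ˢ I) =>
    exists_hasFDerivAt_tangentSweep hp (hd x hx.2) (hβ x hx.2)
  have hS := measurableSet_Ioc.prod hI (s := Set.Ioc 0 (2 * π))
  rw [← planeEquiv_image_tangentSweep,
    ← measurePreserving_planeEquiv.integrableOn_comp_preimage planeEquiv.measurableEmbedding,
    planeEquiv.injective.preimage_image,
    integrableOn_image_iff_integrableOn_abs_det_fderiv_smul volume hS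
      (fun x hx => (hL x hx).hasFDerivWithinAt) (injOn_tangentSweep hp hper hpos hT hinj)]
  refine integrableOn_congr_fun (fun x hx => ?_) hS
  simp [hdet x hx, tangentSweep]

theorem setIntegral_image_tangentPoint (hp : ContDiff ℝ 2 p)
    (hper : Function.Periodic p (2 * π)) (hpos : ∀ φ, 0 < p φ + deriv (deriv p) φ)
    (hI : MeasurableSet I) (hT : ∀ φ, ∀ s ∈ I, 0 < T (φ, s))
    (hinj : ∀ φ, Set.InjOn (fun s => T (φ, s)) I) (hd : ∀ x, x.2 ∈ I → DifferentiableAt ℝ T x)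
    (hβ : ∀ x, x.2 ∈ I → HasDerivAt (fun s => T (x.1, s)) (β x) x.2) (g : Plane → ℝ) :
    ∫ P in (fun x => tangentPoint p x.1 (T x)) '' (Set.Ioc 0 (2 * π) ×ˢ I), g P =
      ∫ x in Set.Ioc 0 (2 * π) ×ˢ I, |β x * T x| * g (tangentPoint p x.1 (T x)) := by
  choose! L hL hdet using fun (x : ℝ × ℝ) (hx : x ∈ Set.Ioc 0 (2 * π) ×ˢ I) =>
    exists_hasFDerivAt_tangentSweep hp (hd x hx.2) (hβ x hx.2)
  have hS := measurableSet_Ioc.prod hI (s := Set.Ioc 0 (2 * π))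
  rw [← planeEquiv_image_tangentSweep,
    ← measurePreserving_planeEquiv.setIntegral_preimage_emb planeEquiv.measurableEmbedding,
    planeEquiv.injective.preimage_image,
    integral_image_eq_integral_abs_det_fderiv_smul volume hS
      (fun x hx => (hL x hx).hasFDerivWithinAt) (injOn_tangentSweep hp hper hpos hT hinj)]
  refine setIntegral_congr_fun hS fun x hx => ?_
  simp [hdet x hx, tangentSweep]

end TangentSweep

/-! ### The visual angle -/

theorem angle_neg_tangentVec_tangentVec_add (φ : ℝ) {s : ℝ} (hs : s ∈ Set.Icc 0 π) :
    InnerProductGeometry.angle (-tangentVec φ) (tangentVec (φ + s)) = π - s := by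
  rw [InnerProductGeometry.angle_neg_left, InnerProductGeometry.angle, norm_tangentVec,
    norm_tangentVec, ← normalVec_add_pi_div_two, ← normalVec_add_pi_div_two,
    inner_normalVec_normalVec, mul_one, div_one,
    show φ + s + π / 2 - (φ + π / 2) = s by ring, arccos_cos hs.1 hs.2]

theorem inner_tangentMeet_normalVec_add (p : ℝ → ℝ) (φ : ℝ) {s : ℝ} (hs : sin s ≠ 0) :
    ⟪tangentMeet p φ s, normalVec (φ + s)⟫ = p (φ + s) := by
  have h := sub_inner_tangentPoint p φ (tangentLength p φ s) s
  rw [tangentLength, div_mul_cancel₀ _ hs, sub_self, sub_eq_zero] at h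
  exact h.symm

theorem tangentMeet_add_neg (p : ℝ → ℝ) (φ : ℝ) {s : ℝ} (hs : sin s ≠ 0) :
    tangentMeet p (φ + s) (-s) = tangentMeet p φ s := by
  have hmeet := tangentPoint_sub_deriv_of_inner_eq (inner_tangentMeet_normalVec_add p φ hs)
  set t := ⟪tangentMeet p φ s, tangentVec (φ + s)⟫ - deriv p (φ + s)
  have hdist := sub_inner_tangentPoint p (φ + s) t (-s)
  rw [hmeet, add_neg_cancel_right, tangentMeet, inner_tangentPoint_normalVec, sub_self] at hdist
  rw [← hmeet, tangentMeet, tangentLength, div_eq_of_eq_mul _ (sub_eq_zero.1 hdist.symm)]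
  rwa [sin_neg, neg_ne_zero]

theorem boundaryCurve_sub_tangentPoint (K : Set Plane) (φ t : ℝ) :
    boundaryCurve K φ - tangentPoint (supportFn K) φ t = t • -tangentVec φ := by
  rw [tangentPoint, boundaryCurve, sub_add_cancel_left, smul_neg]

theorem inner_boundaryCurve_normalVec (K : Set Plane) (φ : ℝ) :
    ⟪boundaryCurve K φ, normalVec φ⟫ = supportFn K φ := by
  simpa [tangentPoint, boundaryCurve] using inner_tangentPoint_normalVec (supportFn K) φ 0

namespace IsOval

variable {K : Set Plane}

theorem boundaryCurve_mem (hK : IsOval K) (φ : ℝ) : boundaryCurve K φ ∈ K :=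
  PlaneConvex.boundaryCurve_mem hK.nonempty hK.isCompact (hK.differentiable_supportFn φ)

theorem tangencyPoints_tangentMeet (hK : IsOval K) (φ : ℝ) {s : ℝ} (hs : s ∈ Set.Ioo 0 π) :
    tangencyPoints K (tangentMeet (supportFn K) φ s) =
      {boundaryCurve K φ, boundaryCurve K (φ + s)} := by
  have hC2 := hK.contDiff_supportFn
  have hpos := hK.curvatureRadius_pos
  ext x
  constructor
  · rintro ⟨hx, ψ, hxψ, hPψ⟩
    have hper : Function.Periodic (fun ψ => (normalVec ψ, supportFn K ψ)) (2 * π) := fun ψ => by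
      simp only [periodic_normalVec ψ, periodic_supportFn K ψ]
    obtain ⟨u, hu, hψu⟩ := hper.exists_mem_Ico two_pi_pos ψ φ
    obtain ⟨hN, hp⟩ := Prod.mk.inj hψu
    rw [hN, hp] at hxψ hPψ
    rw [eq_boundaryCurve hK.isCompact (hK.differentiable_supportFn u) hx hxψ]
    rcases hu.1.eq_or_lt with rfl | hφu
    · exact Or.inl rfl
    · rw [← add_sub_cancel φ u, tangentMeet, inner_tangentPoint_eq_iff hC2 (periodic_supportFn K)
        hpos φ (tangentLength_pos hC2 hpos φ hs) (by linarith) (by linarith [hu.2])] at hPψ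
      have hus : u - φ = s := (strictMonoOn_tangentLength hC2 hpos φ).injOn
        ⟨by linarith, hPψ.1⟩ hs hPψ.2
      exact Or.inr (by rw [← hus, add_sub_cancel]; rfl)
  · rintro (rfl | rfl)
    · exact ⟨hK.boundaryCurve_mem _, φ, inner_boundaryCurve_normalVec K φ,
        inner_tangentPoint_normalVec _ _ _⟩
    · exact ⟨hK.boundaryCurve_mem _, φ + s, inner_boundaryCurve_normalVec K _,
        inner_tangentMeet_normalVec_add _ _ (sin_pos_of_mem_Ioo hs).ne'⟩

theorem angle_boundaryCurve_tangentMeet (hK : IsOval K) (φ : ℝ) {s : ℝ} (hs : s ∈ Set.Ioo 0 π) :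
    EuclideanGeometry.angle (boundaryCurve K φ) (tangentMeet (supportFn K) φ s)
      (boundaryCurve K (φ + s)) = π - s := by
  have hsin := sin_pos_of_mem_Ioo hs
  have hback : tangentLength (supportFn K) (φ + s) (-s) < 0 := by
    rw [tangentLength, sin_neg]
    exact div_neg_of_pos_of_neg (supportGap_neg_pos hK.contDiff_supportFn hK.curvatureRadius_pos _
      hs.1 hs.2.le) (neg_neg_of_pos hsin)
  have hforth := tangentLength_pos hK.contDiff_supportFn hK.curvatureRadius_pos φ hs
  have hsub : boundaryCurve K φ - tangentMeet (supportFn K) φ s =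
      tangentLength (supportFn K) φ s • -tangentVec φ := boundaryCurve_sub_tangentPoint ..
  have hsub_add : boundaryCurve K (φ + s) - tangentMeet (supportFn K) φ s =
      -tangentLength (supportFn K) (φ + s) (-s) • tangentVec (φ + s) := by
    rw [← tangentMeet_add_neg _ _ hsin.ne', tangentMeet, boundaryCurve_sub_tangentPoint, smul_neg,
      neg_smul]
  rw [EuclideanGeometry.angle, vsub_eq_sub, vsub_eq_sub, hsub, hsub_add,
    InnerProductGeometry.angle_smul_left_of_pos _ _ hforth,
    InnerProductGeometry.angle_smul_right_of_pos _ _ (neg_pos.2 hback),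
    angle_neg_tangentVec_tangentVec_add φ ⟨hs.1.le, hs.2.le⟩]

theorem visualAngle_tangentMeet (hK : IsOval K) (φ : ℝ) {s : ℝ} (hs : s ∈ Set.Ioo 0 π) :
    visualAngle K (tangentMeet (supportFn K) φ s) = π - s := by
  have hangle := hK.angle_boundaryCurve_tangentMeet φ hs
  have hne (ψ : ℝ) : boundaryCurve K ψ ≠ tangentMeet (supportFn K) φ s := fun h =>
    tangentPoint_notMem hK.isCompact (hK.differentiable_supportFn φ)
      (tangentLength_pos hK.contDiff_supportFn hK.curvatureRadius_pos φ hs).ne'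
      (h.symm ▸ hK.boundaryCurve_mem ψ :)
  rw [visualAngle, hK.tangencyPoints_tangentMeet φ hs]
  refine IsGreatest.csSup_eq ⟨⟨_, Or.inl rfl, _, Or.inr rfl, hangle.symm⟩, ?_⟩
  rintro θ ⟨x, rfl | rfl, y, rfl | rfl, rfl⟩
  · rw [EuclideanGeometry.angle_self_of_ne (hne _)]
    linarith [hs.2]
  · exact hangle.le
  · exact (EuclideanGeometry.angle_comm _ _ _).trans_le hangle.le
  · rw [EuclideanGeometry.angle_self_of_ne (hne _)]
    linarith [hs.2]

end IsOval

/-! ### The integral of `sin³ ω` -/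

/-- The product of the distances of the envelope points `φ` and `φ + s` from each other's
support lines. -/
noncomputable def gapProduct (p : ℝ → ℝ) (φ s : ℝ) : ℝ :=
  supportGap p φ s * supportGap p (φ + s) (-s)

theorem continuous_gapProduct {p : ℝ → ℝ} (hp : ContDiff ℝ 2 p) :
    Continuous fun x : ℝ × ℝ => gapProduct p x.1 x.2 := by
  have := hp.continuous
  have := (contDiff_one_deriv hp).continuous
  unfold gapProduct supportGap
  fun_prop

theorem integrableOn_gapProduct {p : ℝ → ℝ} (hp : ContDiff ℝ 2 p) (a b c d : ℝ) :
    IntegrableOn (fun x : ℝ × ℝ => gapProduct p x.1 x.2) (Set.Ioc a b ×ˢ Set.Ioo c d) :=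
  ((continuous_gapProduct hp).continuousOn.integrableOn_compact
    (isCompact_Icc.prod isCompact_Icc)).mono_set
      (Set.prod_mono Set.Ioc_subset_Icc_self Set.Ioo_subset_Icc_self)

theorem differentiableAt_tangentLength {p : ℝ → ℝ} (hp : ContDiff ℝ 2 p) {x : ℝ × ℝ}
    (hx : sin x.2 ≠ 0) : DifferentiableAt ℝ (fun x : ℝ × ℝ => tangentLength p x.1 x.2) x := by
  have := hp.differentiable two_ne_zero
  have := (contDiff_one_deriv hp).differentiable one_ne_zero
  unfold tangentLength supportGap
  fun_prop (disch := assumption)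

namespace IsOval

variable {K : Set Plane}

/-- In tangent coordinates the area element is `supportGap p φ s * supportGap p (φ + s) (-s) /
sin s ^ 3`, and the cube of the sine of the visual angle cancels the denominator. -/
theorem areaElement_mul_sin_visualAngle (hK : IsOval K) (φ : ℝ) {s : ℝ} (hs : s ∈ Set.Ioo 0 π) :
    |supportGap (supportFn K) (φ + s) (-s) / sin s ^ 2 * tangentLength (supportFn K) φ s| *
      sin (visualAngle K (tangentMeet (supportFn K) φ s)) ^ 3 = gapProduct (supportFn K) φ s := by
  have hsin := sin_pos_of_mem_Ioo hs
  have hlen := tangentLength_pos hK.contDiff_supportFn hK.curvatureRadius_pos φ hs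
  have hgap := supportGap_neg_pos hK.contDiff_supportFn hK.curvatureRadius_pos (φ + s) hs.1 hs.2.le
  rw [hK.visualAngle_tangentMeet φ hs, abs_of_pos (by positivity), sin_pi_sub, tangentLength,
    gapProduct]
  field_simp

theorem integrableOn_sin_visualAngle (hK : IsOval K) :
    IntegrableOn (fun P => sin (visualAngle K P) ^ 3) Kᶜ := by
  have hC2 := hK.contDiff_supportFn
  have hpos := hK.curvatureRadius_pos
  have hchange := integrableOn_image_tangentPoint_iff hC2 (periodic_supportFn K) hpos
    measurableSet_Ioo (fun φ s hs => tangentLength_pos hC2 hpos φ hs)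
    (fun φ => (strictMonoOn_tangentLength hC2 hpos φ).injOn)
    (fun x hx => differentiableAt_tangentLength hC2 (sin_pos_of_mem_Ioo hx).ne')
    (fun x hx => hasDerivAt_tangentLength hK.differentiable_supportFn x.1
      (sin_pos_of_mem_Ioo hx).ne')
    (fun P => sin (visualAngle K P) ^ 3)
  rw [← hK.image_tangentMeet]
  exact hchange.2 ((integrableOn_gapProduct hC2 _ _ _ _).congr_fun
    (fun x hx => (hK.areaElement_mul_sin_visualAngle x.1 hx.2).symm)
    (measurableSet_Ioc.prod measurableSet_Ioo))

theorem integral_sin_visualAngle (hK : IsOval K) :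
    ∫ P in Kᶜ, sin (visualAngle K P) ^ 3 =
      ∫ φ in 0..2 * π, ∫ s in 0..π, gapProduct (supportFn K) φ s := by
  have hC2 := hK.contDiff_supportFn
  have hpos := hK.curvatureRadius_pos
  have hchange := setIntegral_image_tangentPoint hC2 (periodic_supportFn K) hpos measurableSet_Ioo
    (fun φ s hs => tangentLength_pos hC2 hpos φ hs)
    (fun φ => (strictMonoOn_tangentLength hC2 hpos φ).injOn)
    (fun x hx => differentiableAt_tangentLength hC2 (sin_pos_of_mem_Ioo hx).ne')
    (fun x hx => hasDerivAt_tangentLength hK.differentiable_supportFn x.1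
      (sin_pos_of_mem_Ioo hx).ne')
    (fun P => sin (visualAngle K P) ^ 3)
  calc ∫ P in Kᶜ, sin (visualAngle K P) ^ 3
      = ∫ x in Set.Ioc 0 (2 * π) ×ˢ Set.Ioo 0 π, gapProduct (supportFn K) x.1 x.2 := by
        rw [← hK.image_tangentMeet]
        refine hchange.trans (setIntegral_congr_fun (measurableSet_Ioc.prod measurableSet_Ioo)
          fun x hx => hK.areaElement_mul_sin_visualAngle x.1 hx.2)
    _ = ∫ φ in Set.Ioc 0 (2 * π), ∫ s in Set.Ioo 0 π, gapProduct (supportFn K) φ s :=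
        setIntegral_prod _ (integrableOn_gapProduct hC2 _ _ _ _)
    _ = ∫ φ in 0..2 * π, ∫ s in 0..π, gapProduct (supportFn K) φ s := by
        simp only [intervalIntegral.integral_of_le two_pi_pos.le,
          intervalIntegral.integral_of_le pi_pos.le, integral_Ioc_eq_integral_Ioo]

end IsOval

/-! ### The area -/

/-- The distance from the envelope point `φ` at which the tangent ray leaves the disk of radius `R`
centred at the origin. It is meaningful when that disk contains the envelope point. -/
noncomputable def exitLength (p : ℝ → ℝ) (R φ : ℝ) : ℝ := √(R ^ 2 - p φ ^ 2) - deriv p φ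

section ExitLength

variable {p : ℝ → ℝ} {R : ℝ}

theorem norm_tangentPoint_sq (p : ℝ → ℝ) (φ t : ℝ) :
    ‖tangentPoint p φ t‖ ^ 2 = p φ ^ 2 + (deriv p φ + t) ^ 2 := by
  rw [← real_inner_self_eq_norm_sq]
  nth_rw 2 [tangentPoint_eq]
  rw [inner_add_right, real_inner_smul_right, real_inner_smul_right, inner_tangentPoint_normalVec,
    inner_tangentPoint_tangentVec]
  ring

theorem abs_deriv_lt_sqrt {φ : ℝ} (h : p φ ^ 2 + deriv p φ ^ 2 < R ^ 2) :
    |deriv p φ| < √(R ^ 2 - p φ ^ 2) := by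
  rw [← sqrt_sq_eq_abs]
  exact sqrt_lt_sqrt (sq_nonneg _) (by linarith)

theorem exitLength_pos {φ : ℝ} (h : p φ ^ 2 + deriv p φ ^ 2 < R ^ 2) : 0 < exitLength p R φ :=
  sub_pos.2 ((le_abs_self _).trans_lt (abs_deriv_lt_sqrt h))

theorem norm_tangentPoint_lt_iff (hR : 0 ≤ R) {φ t : ℝ} (h : p φ ^ 2 + deriv p φ ^ 2 < R ^ 2)
    (ht : 0 ≤ t) : ‖tangentPoint p φ t‖ < R ↔ t < exitLength p R φ := by
  have habs := (abs_lt.1 (abs_deriv_lt_sqrt h)).1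
  rw [← sq_lt_sq₀ (norm_nonneg _) hR, norm_tangentPoint_sq, ← lt_sub_iff_add_lt', Real.sq_lt,
    exitLength, lt_sub_iff_add_lt']
  exact and_iff_right (by linarith)

theorem differentiable_exitLength (hp : ContDiff ℝ 2 p)
    (hR : ∀ φ, p φ ^ 2 + deriv p φ ^ 2 < R ^ 2) : Differentiable ℝ (exitLength p R) := by
  have := hp.differentiable two_ne_zero
  have := (contDiff_one_deriv hp).differentiable one_ne_zero
  have hne (φ : ℝ) : R ^ 2 - p φ ^ 2 ≠ 0 := by
    linarith [hR φ, sq_nonneg (deriv p φ)] |> ne_of_gt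
  unfold exitLength
  fun_prop (disch := exact hne _)

theorem integral_exitLength_sq (hp : ContDiff ℝ 1 p) (hper : Function.Periodic p (2 * π))
    (hR : ∀ φ, p φ ^ 2 ≤ R ^ 2) :
    ∫ φ in 0..2 * π, exitLength p R φ ^ 2 = 2 * (π * R ^ 2 - signedArea p) := by
  have hp' := hp.continuous_deriv_one
  have hexact : ∫ φ in 0..2 * π, √(R ^ 2 - p φ ^ 2) * deriv p φ = 0 := by
    have hsub := intervalIntegral.integral_comp_mul_deriv (a := 0) (b := 2 * π)
      (fun φ _ => (hp.differentiable one_ne_zero φ).hasDerivAt) hp'.continuousOn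
      (g := fun u => √(R ^ 2 - u ^ 2)) (by fun_prop)
    rw [← zero_add (2 * π), hper, intervalIntegral.integral_same] at hsub
    rwa [zero_add] at hsub
  have hexpand (φ : ℝ) : exitLength p R φ ^ 2 =
      R ^ 2 - (p φ ^ 2 - deriv p φ ^ 2) - 2 * (√(R ^ 2 - p φ ^ 2) * deriv p φ) := by
    rw [exitLength, sub_sq, sq_sqrt (sub_nonneg.2 (hR φ))]
    ring
  have := hp.continuous
  simp only [hexpand]
  rw [intervalIntegral.integral_sub, intervalIntegral.integral_sub,
    intervalIntegral.integral_const_mul, hexact, signedArea, intervalIntegral.integral_const,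
    smul_eq_mul]
  · ring
  all_goals exact Continuous.intervalIntegrable (by fun_prop) _ _

end ExitLength

namespace IsOval

variable {K : Set Plane} {R : ℝ}

theorem supportFn_sq_add_deriv_sq_lt (hK : IsOval K) (hKR : K ⊆ Metric.ball 0 R) (φ : ℝ) :
    supportFn K φ ^ 2 + deriv (supportFn K) φ ^ 2 < R ^ 2 := by
  have hmem := mem_ball_zero_iff.1 (hKR (hK.boundaryCurve_mem φ))
  have hnorm : ‖boundaryCurve K φ‖ ^ 2 = supportFn K φ ^ 2 + deriv (supportFn K) φ ^ 2 := by
    simpa [tangentPoint, boundaryCurve] using norm_tangentPoint_sq (supportFn K) φ 0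
  rw [← hnorm]
  exact pow_lt_pow_left₀ hmem (norm_nonneg _) two_ne_zero

theorem image_tangentPoint_exitLength (hK : IsOval K) (hR : 0 ≤ R) (hKR : K ⊆ Metric.ball 0 R) :
    (fun x : ℝ × ℝ => tangentPoint (supportFn K) x.1 (exitLength (supportFn K) R x.1 * x.2)) ''
      (Set.Ioc 0 (2 * π) ×ˢ Set.Ioo 0 1) = Metric.ball 0 R \ K := by
  have hlt := hK.supportFn_sq_add_deriv_sq_lt hKR
  have hexit φ := exitLength_pos (hlt φ)
  ext P
  constructor
  · rintro ⟨⟨φ, s⟩, ⟨-, hs⟩, rfl⟩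
    have ht := mul_pos (hexit φ) hs.1
    refine ⟨mem_ball_zero_iff.2 ((norm_tangentPoint_lt_iff hR (hlt φ) ht.le).2 ?_),
      tangentPoint_notMem hK.isCompact (hK.differentiable_supportFn φ) ht.ne'⟩
    exact mul_lt_of_lt_one_right (hexit φ) hs.2
  · rintro ⟨hPR, hP⟩
    obtain ⟨φ, hφ, t, ht, rfl⟩ := hK.exists_tangentPoint_eq hP
    rw [mem_ball_zero_iff, norm_tangentPoint_lt_iff hR (hlt φ) ht.le] at hPR
    refine ⟨(φ, t / exitLength (supportFn K) R φ),
      ⟨hφ, div_pos ht (hexit φ), (div_lt_one (hexit φ)).2 hPR⟩, ?_⟩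
    simp only [mul_div_cancel₀ _ (hexit φ).ne']

theorem volume_ball_sdiff (hK : IsOval K) (hR : 0 ≤ R) (hKR : K ⊆ Metric.ball 0 R) :
    volume.real (Metric.ball 0 R \ K) = π * R ^ 2 - signedArea (supportFn K) := by
  set p := supportFn K
  have hC2 := hK.contDiff_supportFn
  have hlt := hK.supportFn_sq_add_deriv_sq_lt hKR
  have hexit φ := exitLength_pos (hlt φ)
  have hchange := setIntegral_image_tangentPoint (I := Set.Ioo 0 1) hC2
    (periodic_supportFn K) hK.curvatureRadius_pos measurableSet_Ioo
    (T := fun x => exitLength p R x.1 * x.2) (β := fun x => exitLength p R x.1)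
    (fun φ s hs => mul_pos (hexit φ) hs.1) (fun φ s _ u _ h => mul_left_cancel₀ (hexit φ).ne' h)
    (fun x _ => ((differentiable_exitLength hC2 hlt).comp differentiable_fst x).mul
      differentiableAt_snd)
    (fun x _ => hasDerivAt_const_mul (exitLength p R x.1)) (fun _ => 1)
  calc volume.real (Metric.ball 0 R \ K)
      = ∫ x in Set.Ioc 0 (2 * π) ×ˢ Set.Ioo 0 1, exitLength p R x.1 ^ 2 * x.2 := by
        rw [← setIntegral_one_eq_measureReal, ← hK.image_tangentPoint_exitLength hR hKR]
        refine hchange.trans (setIntegral_congr_fun (measurableSet_Ioc.prod measurableSet_Ioo)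
          fun x hx => ?_)
        have hs := hx.2.1
        have := hexit x.1
        simp only [mul_one]
        rw [abs_of_pos (by positivity)]
        ring
    _ = (∫ φ in 0..2 * π, exitLength p R φ ^ 2) * ∫ s in (0 : ℝ)..1, s := by
        rw [intervalIntegral.integral_of_le two_pi_pos.le,
          intervalIntegral.integral_of_le zero_le_one, integral_Ioc_eq_integral_Ioo (y := (1 : ℝ))]
        exact setIntegral_prod_mul (fun φ => exitLength p R φ ^ 2) (fun s => s) _ _
    _ = π * R ^ 2 - signedArea p := by
        rw [integral_exitLength_sq (hC2.of_le one_le_two) (periodic_supportFn K)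
          fun φ => by linarith [hlt φ, sq_nonneg (deriv p φ)], integral_id]
        ring

theorem area_eq_signedArea (hK : IsOval K) : area K = signedArea (supportFn K) := by
  obtain ⟨R, hR, hKR⟩ := hK.isCompact.isBounded.subset_ball_lt 0 0
  have hsdiff := hK.volume_ball_sdiff hR.le hKR
  have hball : volume.real (Metric.ball (0 : Plane) R) = π * R ^ 2 := by
    simp [measureReal_def, EuclideanSpace.volume_ball_fin_two, hR.le, pi_pos.le, mul_comm]
  rw [measureReal_sdiff hKR hK.isCompact.measurableSet, hball] at hsdiff
  exact sub_right_injective hsdiff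

end IsOval

/-! ### The integral of the gap product -/

section Torus

variable {f p : ℝ → ℝ}

theorem supportGap_add_two_pi_left (hper : Function.Periodic p (2 * π)) (φ s : ℝ) :
    supportGap p (φ + 2 * π) s = supportGap p φ s := by
  rw [supportGap, supportGap, add_right_comm, hper, hper, periodic_deriv hper]

theorem gapProduct_add_two_pi_left (hper : Function.Periodic p (2 * π)) (φ s : ℝ) :
    gapProduct p (φ + 2 * π) s = gapProduct p φ s := by
  rw [gapProduct, gapProduct, supportGap_add_two_pi_left hper, add_right_comm,
    supportGap_add_two_pi_left hper]

theorem gapProduct_add_two_pi (hper : Function.Periodic p (2 * π)) (φ s : ℝ) :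
    gapProduct p φ (s + 2 * π) = gapProduct p φ s := by
  rw [gapProduct, gapProduct, supportGap_add_two_pi hper, ← add_assoc,
    supportGap_add_two_pi_left hper, ← supportGap_add_two_pi hper _ (-(s + 2 * π)), neg_add,
    neg_add_cancel_right]

theorem gapProduct_neg (p : ℝ → ℝ) (φ s : ℝ) : gapProduct p φ (-s) = gapProduct p (φ - s) s := by
  rw [gapProduct, gapProduct, mul_comm, neg_neg, ← sub_eq_add_neg, sub_add_cancel]

theorem integral_comp_sub_of_periodic {T : ℝ} (hf : Function.Periodic f T) (a : ℝ) :
    ∫ x in (0 : ℝ)..T, f (x - a) = ∫ x in (0 : ℝ)..T, f x := by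
  rw [intervalIntegral.integral_comp_sub_right, zero_sub, sub_eq_neg_add,
    hf.intervalIntegral_add_eq (-a) 0, zero_add]

theorem integral_integral_comm {F : ℝ → ℝ → ℝ} (hF : Continuous F.uncurry) (a b c d : ℝ) :
    ∫ x in a..b, ∫ y in c..d, F x y = ∫ y in c..d, ∫ x in a..b, F x y :=
  intervalIntegral_intervalIntegral_swap ((hF.continuousOn.integrableOn_compact
    (isCompact_uIcc.prod isCompact_uIcc)).mono_set
      (Set.prod_mono Set.uIoc_subset_uIcc Set.uIoc_subset_uIcc))

theorem integral_gapProduct_sub (hp : ContDiff ℝ 2 p) (hper : Function.Periodic p (2 * π)) (c : ℝ) :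
    ∫ φ in (0 : ℝ)..(2 * π), ∫ s in (0 : ℝ)..c, gapProduct p (φ - s) s =
      ∫ φ in (0 : ℝ)..(2 * π), ∫ s in (0 : ℝ)..c, gapProduct p φ s := by
  have hcont := continuous_gapProduct hp
  rw [integral_integral_comm (F := fun φ s => gapProduct p (φ - s) s)
      (hcont.comp (by fun_prop : Continuous fun x : ℝ × ℝ => (x.1 - x.2, x.2))),
    integral_integral_comm (F := gapProduct p) hcont]
  exact intervalIntegral.integral_congr fun s _ =>
    integral_comp_sub_of_periodic (f := fun φ => gapProduct p φ s)
      (fun φ => gapProduct_add_two_pi_left hper φ s) s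

theorem integral_gapProduct_two_pi (hp : ContDiff ℝ 2 p) (hper : Function.Periodic p (2 * π)) :
    ∫ φ in (0 : ℝ)..(2 * π), ∫ s in (0 : ℝ)..(2 * π), gapProduct p φ s =
      2 * ∫ φ in (0 : ℝ)..(2 * π), ∫ s in (0 : ℝ)..π, gapProduct p φ s := by
  have hcont := continuous_gapProduct hp
  have hcont_sub : Continuous fun x : ℝ × ℝ => gapProduct p (x.1 - x.2) x.2 :=
    hcont.comp (by fun_prop : Continuous fun x : ℝ × ℝ => (x.1 - x.2, x.2))
  have hsplit (φ : ℝ) : ∫ s in (0 : ℝ)..(2 * π), gapProduct p φ s =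
      (∫ s in (0 : ℝ)..π, gapProduct p φ s) + ∫ s in (0 : ℝ)..π, gapProduct p (φ - s) s := by
    have hφ : Continuous (gapProduct p φ) := hcont.comp (by fun_prop : Continuous fun s => (φ, s))
    have hshift := Function.Periodic.intervalIntegral_add_eq (gapProduct_add_two_pi hper φ) 0 (-π)
    rw [zero_add, two_mul, neg_add_cancel_left, ← two_mul] at hshift
    have hneg := intervalIntegral.integral_comp_neg (a := 0) (b := π) (gapProduct p φ)
    rw [neg_zero] at hneg
    simp only [hshift, ← gapProduct_neg, hneg]
    rw [add_comm, intervalIntegral.integral_add_adjacent_intervals] <;>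
      exact hφ.intervalIntegrable _ _
  simp only [hsplit]
  rw [intervalIntegral.integral_add
      ((intervalIntegral.continuous_parametric_intervalIntegral_of_continuous'
        (f := gapProduct p) hcont 0 π).intervalIntegrable _ _)
      ((intervalIntegral.continuous_parametric_intervalIntegral_of_continuous'
        (f := fun φ s => gapProduct p (φ - s) s) hcont_sub 0 π).intervalIntegrable _ _),
    integral_gapProduct_sub hp hper]
  ring

theorem integral_trigMonomial {k : ℤ} (hk : k ≠ 0) (x y : ℝ) :
    ∫ θ in (0 : ℝ)..(2 * π), trigMonomial k x y θ = 0 := by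
  have h := integral_mul_trigMonomial (f := fun _ => 1) continuous_const k x y
  simpa only [cosCoeff, sinCoeff, one_mul, integral_cos_int_mul, integral_sin_int_mul, hk, if_false,
    mul_zero, add_zero] using h

theorem integral_deriv_mul_trigMonomial (hf : ContDiff ℝ 1 f) (hper : Function.Periodic f (2 * π))
    (k : ℤ) (x y : ℝ) : ∫ θ in (0 : ℝ)..(2 * π), deriv f θ * trigMonomial k x y θ =
      k * (x * sinCoeff f k - y * cosCoeff f k) := by
  rw [integral_mul_trigMonomial hf.continuous_deriv_one, cosCoeff_deriv hf hper,
    sinCoeff_deriv hf hper]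
  ring

/-- Grouped so that the factors depending on `ψ` come first: each summand is then integrated
over `ψ` by reading off a Fourier coefficient. -/
theorem gapProduct_sub (hp : Differentiable ℝ p) (φ ψ : ℝ) :
    gapProduct p φ (ψ - φ) =
      p ψ * trigMonomial 0 (3 / 2 * p φ) 0 ψ
      - deriv p ψ * trigMonomial 0 (deriv p φ / 2) 0 ψ
      + p ψ * trigMonomial 2 ((p φ * cos (2 * φ) - deriv p φ * sin (2 * φ)) / 2)
          ((p φ * sin (2 * φ) + deriv p φ * cos (2 * φ)) / 2) ψ
      + deriv p ψ * trigMonomial 2 ((p φ * sin (2 * φ) + deriv p φ * cos (2 * φ)) / 2)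
          (-((p φ * cos (2 * φ) - deriv p φ * sin (2 * φ)) / 2)) ψ
      - p ψ ^ 2 * trigMonomial 1 (cos φ) (sin φ) ψ
      + deriv (fun ψ => p ψ ^ 2) ψ * trigMonomial 1 (-(sin φ / 2)) (cos φ / 2) ψ
      - trigMonomial 1 (p φ ^ 2 * cos φ - p φ * deriv p φ * sin φ)
          (p φ ^ 2 * sin φ + p φ * deriv p φ * cos φ) ψ := by
  have hsq : deriv (fun ψ => p ψ ^ 2) ψ = 2 * p ψ * deriv p ψ := by
    simpa using ((hp ψ).hasDerivAt.fun_pow 2).deriv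
  have hcos : cos (ψ - φ) = cos ψ * cos φ + sin ψ * sin φ := cos_sub ψ φ
  have hsin : sin (ψ - φ) = sin ψ * cos φ - cos ψ * sin φ := sin_sub ψ φ
  have hcos₂ : 2 * cos (ψ - φ) ^ 2 - 1 = cos (2 * ψ) * cos (2 * φ) + sin (2 * ψ) * sin (2 * φ) := by
    rw [← cos_two_mul, ← cos_sub, mul_sub]
  have hsin₂ : 2 * sin (ψ - φ) * cos (ψ - φ) =
      sin (2 * ψ) * cos (2 * φ) - cos (2 * ψ) * sin (2 * φ) := by
    rw [← sin_two_mul, ← sin_sub, mul_sub]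
  simp only [gapProduct, supportGap, trigMonomial, hsq, cos_neg, sin_neg, add_sub_cancel,
    ← sub_eq_add_neg, sub_sub_cancel, Int.cast_zero, Int.cast_one, Int.cast_ofNat, zero_mul,
    one_mul, cos_zero, sin_zero]
  linear_combination (-(p ψ ^ 2) - p φ ^ 2) * hcos + (p ψ * deriv p ψ - p φ * deriv p φ) * hsin
    + (p φ * p ψ + deriv p φ * deriv p ψ) / 2 * hcos₂
    + (deriv p φ * p ψ - p φ * deriv p ψ) / 2 * hsin₂
    - deriv p φ * deriv p ψ * sin_sq_add_cos_sq (ψ - φ)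

theorem integral_gapProduct_inner (hp : ContDiff ℝ 2 p) (hper : Function.Periodic p (2 * π))
    (φ : ℝ) : ∫ s in (0 : ℝ)..(2 * π), gapProduct p φ s =
      3 / 2 * (p φ * (∫ ψ in (0 : ℝ)..(2 * π), p ψ)
        + p φ * trigMonomial 2 (cosCoeff p 2) (sinCoeff p 2) φ
        + deriv p φ * trigMonomial 2 (sinCoeff p 2) (-cosCoeff p 2) φ
        - trigMonomial 1 (cosCoeff (fun ψ => p ψ ^ 2) 1) (sinCoeff (fun ψ => p ψ ^ 2) 1) φ) := by
  have hp₁ := hp.of_le one_le_two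
  have hsq : ContDiff ℝ 1 fun ψ => p ψ ^ 2 := hp₁.pow 2
  have hsqper : Function.Periodic (fun ψ => p ψ ^ 2) (2 * π) := fun ψ => by simp only [hper ψ]
  have := hp.continuous
  have := hp₁.continuous_deriv_one
  have := hsq.continuous_deriv_one
  have := continuous_trigMonomial
  rw [← integral_comp_sub_of_periodic (gapProduct_add_two_pi hper φ) φ]
  simp only [gapProduct_sub (hp.differentiable two_ne_zero) φ]
  rw [intervalIntegral.integral_sub, intervalIntegral.integral_add, intervalIntegral.integral_sub,
    intervalIntegral.integral_add, intervalIntegral.integral_add, intervalIntegral.integral_sub,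
    integral_mul_trigMonomial hp.continuous, integral_mul_trigMonomial hp.continuous,
    integral_mul_trigMonomial hsq.continuous, integral_deriv_mul_trigMonomial hp₁ hper,
    integral_deriv_mul_trigMonomial hp₁ hper, integral_deriv_mul_trigMonomial hsq hsqper,
    integral_trigMonomial one_ne_zero, cosCoeff_zero]
  · simp only [trigMonomial]
    push_cast
    ring_nf
  all_goals exact Continuous.intervalIntegrable (by fun_prop) _ _

theorem integral_gapProduct (hp : ContDiff ℝ 2 p) (hper : Function.Periodic p (2 * π)) :
    ∫ φ in (0 : ℝ)..(2 * π), ∫ s in (0 : ℝ)..π, gapProduct p φ s =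
      3 / 4 * (∫ φ in (0 : ℝ)..(2 * π), p φ) ^ 2 + 9 / 4 * power p 2 := by
  have hp₁ := hp.of_le one_le_two
  have := hp.continuous
  have := hp₁.continuous_deriv_one
  have := continuous_trigMonomial
  have h := integral_gapProduct_two_pi hp hper
  simp only [integral_gapProduct_inner hp hper] at h
  rw [intervalIntegral.integral_const_mul, intervalIntegral.integral_sub,
    intervalIntegral.integral_add, intervalIntegral.integral_add,
    intervalIntegral.integral_mul_const, integral_mul_trigMonomial hp.continuous,
    integral_deriv_mul_trigMonomial hp₁ hper, integral_trigMonomial one_ne_zero] at h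
  · rw [power]
    push_cast at h
    linarith
  all_goals exact Continuous.intervalIntegrable (by fun_prop) _ _

end Torus

/-! ### Length, evolute and Steiner disk -/

section Functionals

variable {f : ℝ → ℝ} {K : Set Plane}

theorem hasDerivAt_envelope (hf : ContDiff ℝ 2 f) (φ : ℝ) :
    HasDerivAt (envelope f) ((f φ + deriv (deriv f) φ) • tangentVec φ) φ := by
  have hf₀ := (hf.differentiable two_ne_zero φ).hasDerivAt
  have hf₁ := ((contDiff_one_deriv hf).differentiable one_ne_zero φ).hasDerivAt
  refine ((hf₀.smul (hasDerivAt_normalVec φ)).add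
    (hf₁.smul (hasDerivAt_tangentVec φ))).congr_deriv ?_
  module

theorem boundaryLength_eq_integral_supportFn (hK : IsOval K) :
    boundaryLength K = ∫ φ in (0 : ℝ)..(2 * π), supportFn K φ := by
  have hC2 := hK.contDiff_supportFn
  have hC1 := contDiff_one_deriv hC2
  have hspeed (φ : ℝ) :
      ‖deriv (boundaryCurve K) φ‖ = supportFn K φ + deriv (deriv (supportFn K)) φ := by
    rw [boundaryCurve, (hasDerivAt_envelope hC2 φ).deriv, norm_smul, norm_tangentVec, mul_one,
      norm_of_nonneg (hK.curvatureRadius_pos φ).le]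
  simp only [boundaryLength, hspeed]
  rw [intervalIntegral.integral_add (hC2.continuous.intervalIntegrable _ _)
      (hC1.continuous_deriv_one.intervalIntegrable _ _),
    integral_deriv_of_periodic hC1 (periodic_deriv (periodic_supportFn K)), add_zero]

theorem evoluteSupportFn_eq (K : Set Plane) (t : ℝ) :
    evoluteSupportFn K t = deriv (supportFn K) (t - π / 2) := by
  rw [evoluteSupportFn, boundaryCurve, envelope, inner_add_left, real_inner_smul_left,
    real_inner_smul_left, inner_normalVec_normalVec, inner_tangentVec_normalVec, sub_sub_cancel,
    cos_pi_div_two, sin_pi_div_two, mul_zero, mul_one, zero_add]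

theorem signedArea_comp_sub (hf : Function.Periodic f (2 * π)) (a : ℝ) :
    signedArea (fun t => f (t - a)) = signedArea f := by
  simp only [signedArea, deriv_comp_sub_const]
  rw [integral_comp_sub_of_periodic (f := fun t => f t ^ 2 - deriv f t ^ 2) fun t => by
    simp only [hf t, periodic_deriv hf t]]

theorem evoluteArea_eq_signedArea (K : Set Plane) :
    evoluteArea K = signedArea (deriv (supportFn K)) := by
  rw [evoluteArea, funext (evoluteSupportFn_eq K),
    signedArea_comp_sub (periodic_deriv (periodic_supportFn K))]

theorem hasSum_signedArea (hf : ContDiff ℝ 1 f) (hper : Function.Periodic f (2 * π)) :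
    HasSum (fun n : ℤ => (1 - n ^ 2) * power f n) (4 * π * signedArea f) := by
  have hf' := hf.continuous_deriv_one
  have hsub := (hasSum_power hf.continuous).sub (hasSum_power hf')
  convert! hsub using 1
  · ext n
    rw [power_deriv hf hper]
    ring
  · have := hf.continuous
    rw [signedArea, intervalIntegral.integral_sub (Continuous.intervalIntegrable (by fun_prop) _ _)
      (Continuous.intervalIntegrable (by fun_prop) _ _)]
    ring

theorem signedArea_deriv_nonpos (hf : ContDiff ℝ 2 f) (hper : Function.Periodic f (2 * π)) :
    signedArea (deriv f) ≤ 0 := by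
  have hterm (n : ℤ) : (1 - n ^ 2) * power (deriv f) n ≤ 0 := by
    rw [power_deriv (hf.of_le one_le_two) hper]
    rcases eq_or_ne n 0 with rfl | hn
    · simp
    · have hsq : (1 : ℝ) ≤ n ^ 2 := by exact_mod_cast Order.one_le_iff_pos.2 (sq_pos_of_ne_zero hn)
      exact mul_nonpos_of_nonpos_of_nonneg (by linarith)
        (mul_nonneg (sq_nonneg _) (power_nonneg _ _))
  exact nonpos_of_mul_nonpos_right (hasSum_le hterm
    (hasSum_signedArea (contDiff_one_deriv hf) (periodic_deriv hper)) hasSum_zero) (by positivity)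

theorem supportFn_closedBall (c : Plane) {R : ℝ} (hR : 0 ≤ R) (φ : ℝ) :
    supportFn (Metric.closedBall c R) φ = ⟪c, normalVec φ⟫ + R := by
  refine IsGreatest.csSup_eq ⟨⟨c + R • normalVec φ, ?_, ?_⟩, ?_⟩
  · simp [norm_smul, norm_normalVec, abs_of_nonneg hR]
  · simp [inner_add_left, real_inner_smul_left, norm_normalVec]
  · rintro _ ⟨x, hx, rfl⟩
    have hxc := real_inner_le_norm (x - c) (normalVec φ)
    rw [norm_normalVec, mul_one, inner_sub_left] at hxc
    exact sub_le_iff_le_add'.1 (hxc.trans (mem_closedBall_iff_norm.1 hx))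

theorem trigMonomial_one (c : Plane) (φ : ℝ) :
    trigMonomial 1 (c 0) (c 1) φ = ⟪c, normalVec φ⟫ := by
  rw [trigMonomial, inner_normalVec, Int.cast_one, one_mul]

theorem fourierSum_zero (f : ℝ → ℝ) (θ : ℝ) : fourierSum f 0 θ = cosCoeff f 0 / (2 * π) := by
  rw [fourierSum_apply, Nat.cast_zero, neg_zero, Finset.Icc_self, Finset.sum_singleton,
    trigMonomial, Int.cast_zero, zero_mul, cos_zero, sin_zero]
  ring

theorem fourierSum_succ (f : ℝ → ℝ) (N : ℕ) (θ : ℝ) : fourierSum f (N + 1) θ =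
    fourierSum f N θ + trigMonomial (N + 1) (cosCoeff f (N + 1)) (sinCoeff f (N + 1)) θ / π := by
  have hIcc : Finset.Icc (-((N + 1 : ℕ) : ℤ)) (N + 1 : ℕ) =
      insert (-(N + 1 : ℤ)) (insert (N + 1 : ℤ) (Finset.Icc (-N : ℤ) N)) := by
    ext n
    simp only [Finset.mem_insert, Finset.mem_Icc]
    omega
  have hneg : trigMonomial (-(N + 1)) (cosCoeff f (-(N + 1))) (sinCoeff f (-(N + 1))) θ =
      trigMonomial (N + 1) (cosCoeff f (N + 1)) (sinCoeff f (N + 1)) θ := by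
    rw [cosCoeff_neg, sinCoeff_neg, trigMonomial, trigMonomial, Int.cast_neg, neg_mul (Int.cast _),
      cos_neg, sin_neg, neg_mul_neg]
  rw [fourierSum_apply, fourierSum_apply, hIcc, Finset.sum_insert, Finset.sum_insert, hneg]
  · ring
  · simp
  · simp only [Finset.mem_insert, Finset.mem_Icc]
    omega

theorem steinerPoint_apply (hc : Continuous (supportFn K)) :
    steinerPoint K 0 = cosCoeff (supportFn K) 1 / π ∧
      steinerPoint K 1 = sinCoeff (supportFn K) 1 / π := by
  have hcont : Continuous fun φ => supportFn K φ • normalVec φ := by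
    unfold normalVec
    fun_prop
  have hcoord (i : Fin 2) : steinerPoint K i =
      (1 / π) * ∫ φ in (0 : ℝ)..(2 * π), (supportFn K φ • normalVec φ) i := by
    rw [steinerPoint, PiLp.smul_apply, smul_eq_mul]
    exact congrArg _ ((EuclideanSpace.proj (𝕜 := ℝ) i).intervalIntegral_comp_comm
      (hcont.intervalIntegrable _ _)).symm
  constructor <;> rw [hcoord] <;> simp [normalVec, cosCoeff, sinCoeff, div_eq_inv_mul]

theorem meanWidth_eq (hc : Continuous (supportFn K)) :
    meanWidth K = cosCoeff (supportFn K) 0 / π := by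
  have hshift := integral_comp_sub_of_periodic (periodic_supportFn K) (-π)
  simp only [sub_neg_eq_add] at hshift
  rw [meanWidth, intervalIntegral.integral_add (hc.intervalIntegrable _ _)
    (Continuous.intervalIntegrable (by fun_prop) _ _), hshift, cosCoeff_zero]
  ring

theorem meanWidth_nonneg (hne : K.Nonempty) (hcomp : IsCompact K) : 0 ≤ meanWidth K :=
  mul_nonneg (by positivity) (intervalIntegral.integral_nonneg two_pi_pos.le fun φ _ =>
    supportFn_add_pi_nonneg hne hcomp φ)

theorem supportFn_steinerDisk (hne : K.Nonempty) (hcomp : IsCompact K)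
    (hc : Continuous (supportFn K)) : supportFn (steinerDisk K) = fourierSum (supportFn K) 1 := by
  ext φ
  rw [steinerDisk, supportFn_closedBall _ (div_nonneg (meanWidth_nonneg hne hcomp) zero_le_two),
    ← trigMonomial_one, (steinerPoint_apply hc).1, (steinerPoint_apply hc).2, meanWidth_eq hc,
    fourierSum_succ _ 0, fourierSum_zero, trigMonomial, trigMonomial]
  push_cast
  ring_nf

end Functionals

/-! ### The deficits as quadratic forms in the Fourier coefficients -/

/-- The coefficient of the power of the frequency `n` in the Hurwitz deficit,
see `IsOval.hasSum_hurwitzDeficit`. -/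
noncomputable def hurwitzCoeff (n : ℤ) : ℝ := (n ^ 2 - 1) * (n ^ 2 - 4) / 4

theorem sum_Icc_neg_two_two (g : ℤ → ℝ) :
    ∑ n ∈ Finset.Icc (-2) 2, g n = g (-2) + g (-1) + g 0 + g 1 + g 2 := by
  rw [show Finset.Icc (-2 : ℤ) 2 = {-2, -1, 0, 1, 2} from rfl]
  simp [add_assoc]

theorem hurwitzCoeff_eq_ten {n : ℤ} (hn : n ∉ Finset.Icc (-2) 2) (hn' : n ∈ Finset.Icc (-3) 3) :
    hurwitzCoeff n = 10 := by
  simp only [Finset.mem_Icc] at hn hn'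
  obtain rfl | rfl : n = 3 ∨ n = -3 := by omega
  all_goals norm_num [hurwitzCoeff]

theorem ten_lt_hurwitzCoeff {n : ℤ} (hn : n ∉ Finset.Icc (-3) 3) : 10 < hurwitzCoeff n := by
  have habs : 4 ≤ |n| := by
    simp only [Finset.mem_Icc] at hn
    rw [le_abs]
    omega
  have hsq : (16 : ℝ) ≤ n ^ 2 := by
    have := pow_le_pow_left₀ (by norm_num) habs 2
    rw [sq_abs] at this
    exact_mod_cast this
  rw [hurwitzCoeff]
  nlinarith

theorem ten_le_hurwitzCoeff {n : ℤ} (hn : n ∉ Finset.Icc (-2) 2) : 10 ≤ hurwitzCoeff n := by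
  by_cases hn' : n ∈ Finset.Icc (-3) 3
  exacts [(hurwitzCoeff_eq_ten hn hn').ge, (ten_lt_hurwitzCoeff hn').le]

namespace IsOval

variable {K : Set Plane}

theorem deltaTwo_sq (hK : IsOval K) : deltaTwo K ^ 2 =
    ∫ φ in (0 : ℝ)..(2 * π), (supportFn K - fourierSum (supportFn K) 1) φ ^ 2 := by
  rw [deltaTwo, sq_sqrt (intervalIntegral.integral_nonneg two_pi_pos.le fun _ _ => sq_nonneg _),
    supportFn_steinerDisk hK.nonempty hK.isCompact hK.contDiff_supportFn.continuous]
  rfl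

theorem deficitBound_eq (hK : IsOval K) :
    deficitBound K = 10 * (2 * π * deltaTwo K ^ 2 - 2 * power (supportFn K) 2) := by
  rw [deficitBound, boundaryLength_eq_integral_supportFn hK, hK.integral_sin_visualAngle,
    integral_gapProduct hK.contDiff_supportFn (periodic_supportFn K)]
  ring

theorem hasSum_deficitBound (hK : IsOval K) :
    HasSum (fun n : {n : ℤ // n ∉ Finset.Icc (-2) 2} => 10 * power (supportFn K) n)
      (deficitBound K) := by
  set p := supportFn K
  have hc := hK.contDiff_supportFn.continuous
  have hsum := hasSum_power (hc.sub (continuous_fourierSum p 1))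
  rw [← hK.deltaTwo_sq, funext (power_sub_fourierSum hc 1)] at hsum
  rw [hK.deficitBound_eq]
  refine HasSum.mul_left 10 ?_
  convert! (Finset.hasSum_compl_iff (a := 2 * π * deltaTwo K ^ 2 - 2 * power p 2)
    (f := fun n => if n ∈ Finset.Icc (-(1 : ℕ) : ℤ) (1 : ℕ) then 0 else power p n)
    (Finset.Icc (-2) 2)).2 ?_ using 1
  · ext n
    rw [if_neg fun h => n.2 (Finset.Icc_subset_Icc (by norm_num) (by norm_num) h)]
  · convert! hsum using 1
    simp [sum_Icc_neg_two_two, power_neg, ← two_mul]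

theorem hurwitzDeficit_eq (hK : IsOval K) : hurwitzDeficit K =
    4 * π * signedArea (supportFn K) - π * signedArea (deriv (supportFn K))
      - power (supportFn K) 0 := by
  rw [hurwitzDeficit, isoDeficit, evoluteArea_eq_signedArea,
    abs_of_nonpos (signedArea_deriv_nonpos hK.contDiff_supportFn (periodic_supportFn K)),
    hK.area_eq_signedArea, boundaryLength_eq_integral_supportFn hK, power_zero]
  ring

theorem hasSum_hurwitzDeficit (hK : IsOval K) :
    HasSum (fun n : {n : ℤ // n ∉ Finset.Icc (-2) 2} => hurwitzCoeff n * power (supportFn K) n)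
      (hurwitzDeficit K) := by
  have hC1 := hK.contDiff_supportFn.of_le one_le_two
  have hper := periodic_supportFn K
  have hsum := (hasSum_signedArea hC1 hper).sub
    ((hasSum_signedArea (contDiff_one_deriv hK.contDiff_supportFn) (periodic_deriv hper)).mul_left
      (1 / 4))
  refine (Finset.hasSum_compl_iff (Finset.Icc (-2) 2)
    (f := fun n => hurwitzCoeff n * power (supportFn K) n)).2 ?_
  convert! hsum using 1
  · ext n
    rw [power_deriv hC1 hper, hurwitzCoeff]
    ring
  · rw [hK.hurwitzDeficit_eq, sum_Icc_neg_two_two]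
    norm_num [hurwitzCoeff]
    ring

theorem deficitBound_le_hurwitzDeficit (hK : IsOval K) : deficitBound K ≤ hurwitzDeficit K :=
  hasSum_le (fun n => mul_le_mul_of_nonneg_right (ten_le_hurwitzCoeff n.2) (power_nonneg _ _))
    hK.hasSum_deficitBound hK.hasSum_hurwitzDeficit

theorem deficitBound_nonneg (hK : IsOval K) : 0 ≤ deficitBound K :=
  hK.hasSum_deficitBound.nonneg fun _ => mul_nonneg (by norm_num) (power_nonneg _ _)

theorem hurwitzDeficit_eq_zero (hK : IsOval K) (h : deficitBound K = 0) : hurwitzDeficit K = 0 := by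
  have hbound := hK.hasSum_deficitBound
  rw [h, hasSum_zero_iff_of_nonneg fun n => mul_nonneg (by norm_num) (power_nonneg _ _)] at hbound
  have hpower (n : {n : ℤ // n ∉ Finset.Icc (-2) 2}) : power (supportFn K) n = 0 := by
    simpa using congrFun hbound n
  refine hK.hasSum_hurwitzDeficit.unique ?_
  simpa only [hpower, mul_zero] using hasSum_zero

theorem hurwitzDeficit_eq_deficitBound_iff (hK : IsOval K) :
    hurwitzDeficit K = deficitBound K ↔ ∀ n ∉ Finset.Icc (-3 : ℤ) 3, power (supportFn K) n = 0 := by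
  have hsub := hK.hasSum_hurwitzDeficit.sub hK.hasSum_deficitBound
  simp only [← sub_mul] at hsub
  have hnonneg (n : {n : ℤ // n ∉ Finset.Icc (-2) 2}) :
      0 ≤ (hurwitzCoeff n - 10) * power (supportFn K) n :=
    mul_nonneg (sub_nonneg.2 (ten_le_hurwitzCoeff n.2)) (power_nonneg _ _)
  rw [← sub_eq_zero]
  constructor
  · intro h n hn
    rw [h, hasSum_zero_iff_of_nonneg hnonneg] at hsub
    have hn₂ : n ∉ Finset.Icc (-2) 2 := fun h => hn (Finset.Icc_subset_Icc (by norm_num)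
      (by norm_num) h)
    exact (mul_eq_zero.1 (congrFun hsub ⟨n, hn₂⟩)).resolve_left
      (sub_pos.2 (ten_lt_hurwitzCoeff hn)).ne'
  · intro h
    refine hsub.unique ?_
    convert! hasSum_zero with n
    by_cases hn : n.1 ∈ Finset.Icc (-3) 3
    · rw [hurwitzCoeff_eq_ten n.2 hn, sub_self, zero_mul]
    · rw [h n hn, mul_zero]

end IsOval

/-! ### The case of equality -/

section Equality

variable {K : Set Plane} {h : ℝ → ℝ}

theorem eq_of_supportFn_eq {A B : Set Plane} (hA : A.Nonempty) (hA' : IsCompact A)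
    (hA'' : Convex ℝ A) (hB : B.Nonempty) (hB' : IsCompact B) (hB'' : Convex ℝ B)
    (h : supportFn A = supportFn B) : A = B := by
  ext x
  rw [mem_iff_inner_le_supportFn hA hA' hA'', mem_iff_inner_le_supportFn hB hB' hB'', h]

theorem trigMonomial_zero (d y θ : ℝ) : trigMonomial 0 d y θ = d := by simp [trigMonomial]

theorem trigMonomial_zero_zero (k : ℤ) : trigMonomial k 0 0 = 0 := by
  ext θ
  simp [trigMonomial]

theorem supportFn_closedBall_eq_trigMonomial (c : Plane) {R : ℝ} (hR : 0 ≤ R) :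
    supportFn (Metric.closedBall c R) = trigMonomial 0 R 0 + trigMonomial 1 (c 0) (c 1) := by
  ext φ
  rw [supportFn_closedBall c hR, ← trigMonomial_one, Pi.add_apply, trigMonomial_zero, add_comm]

theorem exists_pos_polar {u v : ℝ} (h : ¬(u = 0 ∧ v = 0)) :
    ∃ R β : ℝ, 0 < R ∧ u = -(R * sin β) ∧ v = R * cos β := by
  refine ⟨‖(⟨v, -u⟩ : ℂ)‖, Complex.arg ⟨v, -u⟩, norm_pos_iff.2 fun h0 => h ?_, ?_, ?_⟩
  · rw [Complex.ext_iff] at h0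
    exact ⟨neg_eq_zero.1 h0.2, h0.1⟩
  · rw [Complex.norm_mul_sin_arg, neg_neg]
  · rw [Complex.norm_mul_cos_arg]

theorem isParallelToHypocycloid_iff {k : ℝ} (hk : 2 < k) {m : ℤ} (hkm : k / (k - 2) = m) :
    IsParallelToHypocycloid k h ↔ ∃ d x y u v : ℝ, ¬(u = 0 ∧ v = 0) ∧
      h = trigMonomial 0 d 0 + trigMonomial 1 x y + trigMonomial m u v := by
  have hk' : 0 < k - 2 := sub_pos.2 hk
  have hexpand (r α θ : ℝ) : hypocycloidSupportFn k r (θ - α) =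
      trigMonomial m (-(r * (k - 2) * sin (m * α))) (r * (k - 2) * cos (m * α)) θ := by
    rw [hypocycloidSupportFn, hkm, mul_sub (m : ℝ), sin_sub, trigMonomial]
    ring
  constructor
  · rintro ⟨r, hr, α, d, c, hh⟩
    refine ⟨d, c 0, c 1, -(r * (k - 2) * sin (m * α)), r * (k - 2) * cos (m * α), fun h₀ => ?_,
      funext fun θ => ?_⟩
    · have hsq := sin_sq_add_cos_sq (m * α)
      simp only [neg_eq_zero, mul_eq_zero, hr.ne', hk'.ne', false_or] at h₀
      simp [h₀] at hsq
    · rw [hh, hexpand, ← trigMonomial_one, Pi.add_apply, Pi.add_apply, trigMonomial_zero]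
      ring
  · rintro ⟨d, x, y, u, v, huv, rfl⟩
    obtain ⟨R, β, hR, rfl, rfl⟩ := exists_pos_polar huv
    have hm : (m : ℝ) ≠ 0 := hkm ▸ (div_pos (by linarith) hk').ne'
    refine ⟨R / (k - 2), div_pos hR hk', β / m, d, !₂[x, y], fun θ => ?_⟩
    rw [hexpand, ← trigMonomial_one, div_mul_cancel₀ _ hk'.ne', mul_div_cancel₀ _ hm]
    rw [Pi.add_apply, Pi.add_apply, trigMonomial_zero]
    exact add_rotate d _ _

theorem isParallelToHypocycloid_four_iff : IsParallelToHypocycloid 4 h ↔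
    ∃ d x y u v : ℝ, ¬(u = 0 ∧ v = 0) ∧
      h = trigMonomial 0 d 0 + trigMonomial 1 x y + trigMonomial 2 u v :=
  isParallelToHypocycloid_iff (by norm_num) (by norm_num)

theorem isParallelToHypocycloid_three_iff : IsParallelToHypocycloid 3 h ↔
    ∃ d x y u v : ℝ, ¬(u = 0 ∧ v = 0) ∧
      h = trigMonomial 0 d 0 + trigMonomial 1 x y + trigMonomial 3 u v :=
  isParallelToHypocycloid_iff (by norm_num) (by norm_num)

theorem IsSummandSupportFn.mem_bandLimited (hh : IsSummandSupportFn h) : h ∈ bandLimited 3 := by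
  have htrig (k : ℤ) (hk : k ∈ Finset.Icc (-(3 : ℕ) : ℤ) (3 : ℕ)) (x y : ℝ) :
      trigMonomial k x y ∈ bandLimited 3 := trigMonomial_mem_bandLimited hk x y
  obtain ⟨_, ⟨c, R, hR, rfl⟩, rfl⟩ | hh | hh := hh
  · rw [supportFn_closedBall_eq_trigMonomial c hR.le]
    exact add_mem (htrig 0 (by simp) _ _) (htrig 1 (by simp) _ _)
  · obtain ⟨d, x, y, u, v, -, rfl⟩ := isParallelToHypocycloid_four_iff.1 hh
    exact add_mem (add_mem (htrig 0 (by simp) _ _) (htrig 1 (by simp) _ _))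
      (htrig 2 (by simp) _ _)
  · obtain ⟨d, x, y, u, v, -, rfl⟩ := isParallelToHypocycloid_three_iff.1 hh
    exact add_mem (add_mem (htrig 0 (by simp) _ _) (htrig 1 (by simp) _ _))
      (htrig 3 (by simp) _ _)

theorem fourierSum_three (f : ℝ → ℝ) : ∃ d x y u v u' v' : ℝ, fourierSum f 3 =
    trigMonomial 0 d 0 + trigMonomial 1 x y + trigMonomial 2 u v + trigMonomial 3 u' v' := by
  refine ⟨cosCoeff f 0 / (2 * π), cosCoeff f 1 / π, sinCoeff f 1 / π, cosCoeff f 2 / π,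
    sinCoeff f 2 / π, cosCoeff f 3 / π, sinCoeff f 3 / π, funext fun θ => ?_⟩
  rw [fourierSum_succ f 2, fourierSum_succ f 1, fourierSum_succ f 0, fourierSum_zero]
  simp only [Pi.add_apply, trigMonomial_zero]
  simp only [trigMonomial]
  push_cast
  ring_nf

theorem IsOval.isDisk_of_supportFn_eq (hK : IsOval K) {d x y : ℝ}
    (hp : supportFn K = trigMonomial 0 d 0 + trigMonomial 1 x y) : IsDisk K := by
  have hd : 0 < d := by
    have hd' : deriv (deriv (supportFn K)) = -trigMonomial 1 x y := by
      have hp' : supportFn K = fun θ => d + trigMonomial 1 x y θ := funext fun θ => by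
        rw [hp, Pi.add_apply, trigMonomial_zero]
      rw [hp', deriv_const_add', deriv_trigMonomial, deriv_trigMonomial]
      ext θ
      rw [Pi.neg_apply, trigMonomial, trigMonomial, Int.cast_one]
      ring
    have hcurv := hK.curvatureRadius_pos 0
    rwa [hd', hp, Pi.add_apply, Pi.neg_apply, add_neg_cancel_right, trigMonomial_zero] at hcurv
  refine ⟨!₂[x, y], d, hd, eq_of_supportFn_eq hK.nonempty hK.isCompact hK.convex
    (Metric.nonempty_closedBall.2 hd.le) (isCompact_closedBall _ _) (convex_closedBall _ _) ?_⟩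
  rw [hp, supportFn_closedBall_eq_trigMonomial _ hd.le]
  rfl

theorem IsOval.supportFn_mem_bandLimited_iff (hK : IsOval K) :
    supportFn K ∈ bandLimited 3 ↔ (IsDisk K ∨ IsBoundedByAstroidParallel K) ∨
      IsBoundedBySteinerParallel K ∨ IsMinkowskiSumOfSummands K := by
  constructor
  · intro hp
    obtain ⟨d, x, y, u, v, u', v', hsum⟩ := fourierSum_three (supportFn K)
    rw [← eq_fourierSum_of_mem_bandLimited hp (periodic_supportFn K)] at hsum
    by_cases huv : u = 0 ∧ v = 0 <;> by_cases huv' : u' = 0 ∧ v' = 0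
    · refine .inl (.inl (hK.isDisk_of_supportFn_eq (d := d) (x := x) (y := y) ?_))
      rw [hsum, huv.1, huv.2, huv'.1, huv'.2, trigMonomial_zero_zero, trigMonomial_zero_zero,
        add_zero, add_zero]
    · refine .inr (.inl (isParallelToHypocycloid_three_iff.2 ⟨d, x, y, u', v', huv', ?_⟩))
      rw [hsum, huv.1, huv.2, trigMonomial_zero_zero, add_zero]
    · refine .inl (.inr (isParallelToHypocycloid_four_iff.2 ⟨d, x, y, u, v, huv, ?_⟩))
      rw [hsum, huv'.1, huv'.2, trigMonomial_zero_zero, add_zero]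
    · refine .inr (.inr ⟨2, ![trigMonomial 0 d 0 + trigMonomial 1 x y + trigMonomial 2 u v,
        trigMonomial 0 0 0 + trigMonomial 1 0 0 + trigMonomial 3 u' v'], le_rfl, ?_, fun φ => ?_⟩)
      · rw [Fin.forall_fin_two]
        exact ⟨.inr (.inl (isParallelToHypocycloid_four_iff.2 ⟨d, x, y, u, v, huv, rfl⟩)),
          .inr (.inr (isParallelToHypocycloid_three_iff.2 ⟨0, 0, 0, u', v', huv', rfl⟩))⟩
      · simp [hsum, trigMonomial_zero_zero]
  · rintro ((h | h) | h | ⟨m, f, -, hf, hsum⟩)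
    · exact IsSummandSupportFn.mem_bandLimited (.inl ⟨K, h, rfl⟩)
    · exact IsSummandSupportFn.mem_bandLimited (.inr (.inl h))
    · exact IsSummandSupportFn.mem_bandLimited (.inr (.inr h))
    · have hsum' : supportFn K = ∑ i, f i := funext fun φ => by rw [hsum, Finset.sum_apply]
      exact hsum' ▸ sum_mem fun i _ => (hf i).mem_bandLimited

end Equality

end PlaneConvex

theorem mainTheorem6 (K : Set Plane) (hne : K.Nonempty) (hcomp : IsCompact K)
    (hconv : Convex ℝ K) (hsmooth : ContDiff ℝ 2 (supportFn K))
    (hcurv : ∀ φ, 0 < supportFn K φ + deriv (deriv (supportFn K)) φ) :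
    IntegrableOn (fun P => sin (visualAngle K P) ^ 3) Kᶜ volume ∧
    deficitBound K ≤ hurwitzDeficit K ∧
    (hurwitzDeficit K ≠ 0 → 0 < deficitBound K) ∧
    (hurwitzDeficit K = 0 → deficitBound K = 0) ∧
    (hurwitzDeficit K = deficitBound K ↔
      (IsDisk K ∨ IsBoundedByAstroidParallel K) ∨
        IsBoundedBySteinerParallel K ∨ IsMinkowskiSumOfSummands K) := by
  have hK : IsOval K := ⟨hne, hcomp, hconv, hsmooth, hcurv⟩
  have hle := hK.deficitBound_le_hurwitzDeficit
  have hnonneg := hK.deficitBound_nonneg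
  refine ⟨hK.integrableOn_sin_visualAngle, hle, fun h => hnonneg.lt_of_ne' ?_,
    fun h => le_antisymm (h ▸ hle) hnonneg, ?_⟩
  · exact mt hK.hurwitzDeficit_eq_zero h
  · rw [hK.hurwitzDeficit_eq_deficitBound_iff, ← hK.supportFn_mem_bandLimited_iff]
    exact (mem_bandLimited_iff hsmooth.continuous).symm
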